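/- For $H\in(1/2,1)$ let $(\epsilon(w))_w$, indexed by the finite words $w$ over $\{0,1\}$, be independent random variables with $\mathbb P(\epsilon(w)=1)=(1+2^{H-1})/2$ and $\mathbb P(\epsilon(w)=-1)=(1-2^{H-1})/2$. For $n\ge 0$ and $0\le k<2^n$ put $\xi^{(n)}_k=\epsilon(w_1)\,\epsilon(w_1w_2)\cdots\epsilon(w_1w_2\cdots w_n)$, where $w_1\cdots w_n\in\{0,1\}^n$ is the word with $\sum_{i=1}^n w_i2^{-i}=k2^{-n}$. Put $S^{(n)}_r=\sum_{0\le k<r}\xi^{(n)}_k$ and, for $t\in[0,1]$, $$B_n(t)=2^{-nH}\Big[S^{(n)}_{[2^nt]}+(2^nt-[2^nt])\,\xi^{(n)}_{[2^nt]}\Big]$$ (the last term being $0$ at $t=1$). Let $\mathcal C([0,1])$ be the space of real continuous functions on $[0,1]$ with the uniform norm, and let $\sigma_H=(2-2^{2-2H})^{-1/2}$. Then for every $H\in(1/2,1)$ the sequence $(B_n)$ converges almost surely in $\mathcal C([0,1])$; denote its limit by $B_H$. As $H$ tends to $1/2$ within $(1/2,1)$, the processes $B_H/\sigma_H$ converge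 in law in $\mathcal C([0,1])$ to the restriction to $[0,1]$ of the standard Brownian motion. -/

import Mathlib

open MeasureTheory ProbabilityTheory Filter
open scoped Topology unitInterval

/-- `C([0,1])` carries the topology of the uniform norm and its Borel σ-algebra. -/
instance instMeasurableSpaceUnitPaths : MeasurableSpace C(I, ℝ) := borel _

instance instBorelSpaceUnitPaths : BorelSpace C(I, ℝ) := ⟨rfl⟩

namespace SignedCascade

noncomputable section

/-- The word `w₁ ⋯ wₙ` over `{0,1}` with `∑ wᵢ 2⁻ⁱ = k 2⁻ⁿ`, for `0 ≤ k < 2ⁿ`: the binary digits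
of `k`, most significant digit first. Words are lists of Booleans. -/
def word (n k : ℕ) : List Bool :=
  List.ofFn fun i : Fin n => k.testBit (n - 1 - i)

/-- `ξ_k^{(n)} = ε(w₁) ε(w₁w₂) ⋯ ε(w₁⋯wₙ)`, where `w₁⋯wₙ = word n k` and `e w` is the value of
the sign `ε(w)`. -/
def pathSign (e : List Bool → ℝ) (n k : ℕ) : ℝ :=
  ∏ j ∈ Finset.range n, e ((word n k).take (j + 1))

/-- The walk `S_r^{(n)} = ∑_{0 ≤ k < r} ξ_k^{(n)}`. -/
def walk (e : List Bool → ℝ) (n r : ℕ) : ℝ :=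
  ∑ k ∈ Finset.range r, pathSign e n k

/-- `B_n(t) = 2^{-nH} (S_{[2ⁿt]}^{(n)} + (2ⁿt - [2ⁿt]) ξ_{[2ⁿt]}^{(n)})`. At `t = 1` the factor
of `ξ_{[2ⁿt]}^{(n)}` is `0`. -/
def approxFun (H : ℝ) (e : List Bool → ℝ) (n : ℕ) (t : ℝ) : ℝ :=
  (2 : ℝ) ^ (-(n * H)) *
    (walk e n ⌊2 ^ n * t⌋₊ + (2 ^ n * t - ⌊2 ^ n * t⌋₊) * pathSign e n ⌊2 ^ n * t⌋₊)

theorem interpolation_eq_sum (a : ℕ → ℝ) (N : ℕ) (x : ℝ) (hx : 0 ≤ x) (hN : x ≤ N) :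
    (∑ k ∈ Finset.range ⌊x⌋₊, a k) + (x - ⌊x⌋₊) * a ⌊x⌋₊ =
      ∑ k ∈ Finset.range N, a k * max 0 (min 1 (x - k)) := by
  have h1 : (⌊x⌋₊ : ℝ) ≤ x := Nat.floor_le hx
  have h2 : x < ⌊x⌋₊ + 1 := Nat.lt_floor_add_one x
  have hfl : ⌊x⌋₊ ≤ N := Nat.floor_le_of_le hN
  have key : (∑ k ∈ Finset.range ⌊x⌋₊, a k) + (x - ⌊x⌋₊) * a ⌊x⌋₊ =
      ∑ k ∈ Finset.range (⌊x⌋₊ + 1), a k * max 0 (min 1 (x - k)) := by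
    rw [Finset.sum_range_succ]
    congr 1
    · refine Finset.sum_congr rfl fun k hk => ?_
      have hk' : (k : ℝ) + 1 ≤ ⌊x⌋₊ := by exact_mod_cast Finset.mem_range.1 hk
      rw [min_eq_left (by linarith), max_eq_right zero_le_one, mul_one]
    · rw [min_eq_right (by linarith), max_eq_right (by linarith), mul_comm]
  have tail : ∀ M, ⌊x⌋₊ + 1 ≤ M → ∑ k ∈ Finset.range M, a k * max 0 (min 1 (x - k)) =
      ∑ k ∈ Finset.range (⌊x⌋₊ + 1), a k * max 0 (min 1 (x - k)) := by
    intro M hM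
    refine (Finset.sum_subset (Finset.range_mono hM) fun k _ hk => ?_).symm
    have hk' : (⌊x⌋₊ : ℝ) + 1 ≤ k := by
      have : ⌊x⌋₊ + 1 ≤ k := by simpa using hk
      exact_mod_cast this
    rw [min_eq_right (by linarith), max_eq_left (by linarith), mul_zero]
  rcases hfl.lt_or_eq with h | h
  · rw [key, tail N h]
  · have hx' : x = N := le_antisymm hN (by rw [← h]; exact h1)
    rw [key, Finset.sum_range_succ, h, hx']
    simp

theorem approxFun_eq_sum (H : ℝ) (e : List Bool → ℝ) (n : ℕ) (t : I) :
    approxFun H e n t = (2 : ℝ) ^ (-(n * H)) *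
      ∑ k ∈ Finset.range (2 ^ n), pathSign e n k * max 0 (min 1 (2 ^ n * (t : ℝ) - k)) := by
  rw [approxFun, walk, interpolation_eq_sum _ (2 ^ n)]
  · exact mul_nonneg (by positivity) t.2.1
  · push_cast
    exact mul_le_of_le_one_right (by positivity) t.2.2

theorem continuous_approxFun (H : ℝ) (e : List Bool → ℝ) (n : ℕ) :
    Continuous fun t : I => approxFun H e n t := by
  simp only [approxFun_eq_sum]
  fun_prop

/-- The random function `B_n` as an element of `C([0,1])`. -/
def approx (H : ℝ) (e : List Bool → ℝ) (n : ℕ) : C(I, ℝ) :=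
  ⟨fun t => approxFun H e n t, continuous_approxFun H e n⟩

/-- The limit `B_H` of `(B_n)` in `C([0,1])` (a junk value where the sequence diverges). -/
def limitPath (H : ℝ) (e : List Bool → ℝ) : C(I, ℝ) :=
  limUnder atTop (approx H e)

/-- `σ_H = (2 - 2^{2-2H})^{-1/2}`. -/
def sigma (H : ℝ) : ℝ := (2 - (2 : ℝ) ^ (2 - 2 * H)) ^ (-(1 / 2) : ℝ)

/-- `(ε(w))`, indexed by the finite words `w` over `{0,1}`, is a family of independent random
variables with values `1` and `-1`, of probability `(1 + 2^{H-1})/2` and `(1 - 2^{H-1})/2`. -/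
structure IsSignFamily {Ω : Type*} [MeasurableSpace Ω] (P : Measure Ω) (H : ℝ)
    (ε : List Bool → Ω → ℝ) : Prop where
  measurable : ∀ w, Measurable (ε w)
  indep : iIndepFun ε P
  prob_one : ∀ w, P {ω | ε w ω = 1} = ENNReal.ofReal ((1 + (2 : ℝ) ^ (H - 1)) / 2)
  prob_neg_one : ∀ w, P {ω | ε w ω = -1} = ENNReal.ofReal ((1 - (2 : ℝ) ^ (H - 1)) / 2)

/-- Wiener measure on `C([0,1])`, the law of the restriction to `[0,1]` of standard Brownian
motion: under it the coordinate process `t ↦ f t` starts at `0` and has independent increments,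
the increment from `s` to `t` being centred Gaussian of variance `t - s`. -/
structure IsWienerMeasure (μ : Measure C(I, ℝ)) : Prop where
  start : ∀ᵐ f ∂μ, f 0 = 0
  indep : HasIndepIncrements (fun (t : I) (f : C(I, ℝ)) => f t) μ
  law : ∀ s t : I, s ≤ t →
    HasLaw (fun f : C(I, ℝ) => f t - f s) (gaussianReal 0 (Real.toNNReal ((t : ℝ) - s))) μ

end

end SignedCascade

/-!
The theorem rests on a self-similarity of the signed cascade. Write `h = 2^{-H}`. All words that
start with the letter `b` share the factor `ε(b)`, so `B_{n+1}` is the concatenation (`glue`) of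
two independent copies of `h ε B_n`, each run at double speed (`approx_succ`). On the level of
laws this is the grafting operation `graftLaw`, and all moments of `B_n(1)` as well as norms of
paths are controlled by recursions along it.

*Almost sure convergence.* The increments `B_{n+1} - B_n` obey the same recursion, and their
endpoints are centred. As `‖glue (f, g)‖` is at most `max ‖f‖ ‖g‖ + |f 1|`, the fourth moment of
the uniform norm decays like `(4 h⁴)^n`, where `4 h⁴ < 1` because `H > 1/2`
(`exists_norm_iterLaw_le`). Hence the increments are almost surely summable.

*Limit of the endpoint.* The law `limitProb H` of `B_H / σ_H` is a fixed point of grafting. For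
its endpoint, of variance `1`, mean `1/σ_H → 0` and bounded fourth moment, this yields a relation
between the characteristic function at `s` and at `h s` that is almost the one satisfied by a
standard Gaussian. Iterating it down to small `s`, where the expansion of order two applies, gives
convergence to the standard Gaussian as `H → 1/2` (`tendsto_map_eval_one_limitProb`).

*Finite-dimensional limits and tightness.* Grafting commutes with piecewise linear interpolation
at dyadic points and is continuous for weak convergence. So by induction on the level `N` the law
of the interpolation of `B_H / σ_H` tends to the law `gaussProb N`, obtained from a Gaussian
endpoint by `N` graftings at `H = 1/2` (`tendsto_interpProb_limitProb`). The difference of a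
path and its interpolation vanishes at the endpoint, so that its fourth moment is at most
multiplied by `2 h⁴ ≤ 1/2` in each step: the interpolation error is `O(2^{-N})` uniformly in `H`
(`interp_error_approxProb_le`). This uniformity replaces a compactness argument.

*Wiener measure.* The laws `gaussProb N` are those of the midpoint displacement construction of
Brownian motion: by rotation invariance of the standard Gaussian in the plane, the normalized sum and
difference of end value and midpoint displacement drive the two halves independently
(`map_smul_line_add_bridge`). This construction converges almost surely, and the law `wiener` of
its limit is again a fixed point of grafting. From the fixed point equation the joint
characteristic function of increments at dyadic times is computed by induction on the level,
starting from times in `{0, 1}` (`incrChar_eq_of_dyadic`); continuity of paths extends the formula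
to all times.
-/

namespace SignedCascade

/-! ### Concatenation of paths -/

/-- The time change `t ↦ min (2t) 1`, running through `[0,1]` during the first half. -/
noncomputable def firstHalf (t : I) : I := Set.projIcc 0 1 zero_le_one (2 * (t : ℝ))

/-- The time change `t ↦ max (2t - 1) 0`, running through `[0,1]` during the second half. -/
noncomputable def secondHalf (t : I) : I := Set.projIcc 0 1 zero_le_one (2 * (t : ℝ) - 1)

@[fun_prop]
theorem continuous_firstHalf : Continuous firstHalf :=
  continuous_projIcc.comp (by fun_prop)

@[fun_prop]
theorem continuous_secondHalf : Continuous secondHalf :=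
  continuous_projIcc.comp (by fun_prop)

theorem coe_firstHalf (t : I) : (firstHalf t : ℝ) = min (2 * (t : ℝ)) 1 := by
  have := t.2.1
  rw [firstHalf, Set.coe_projIcc, min_comm, max_eq_right]
  exact le_min (by linarith) zero_le_one

theorem coe_secondHalf (t : I) : (secondHalf t : ℝ) = max (2 * (t : ℝ) - 1) 0 := by
  have := t.2.2
  rw [secondHalf, Set.coe_projIcc, min_eq_right (by linarith), max_comm]

theorem monotone_firstHalf : Monotone firstHalf := fun s t h =>
  Set.monotone_projIcc _ (by have : (s : ℝ) ≤ t := h; linarith)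

theorem monotone_secondHalf : Monotone secondHalf := fun s t h =>
  Set.monotone_projIcc _ (by have : (s : ℝ) ≤ t := h; linarith)

/-- A point of the second half has run through the first half completely, and conversely a point
of the first half has not entered the second. -/
theorem halves_cases (t : I) : secondHalf t = 0 ∨ firstHalf t = 1 := by
  rcases le_total (2 * (t : ℝ)) 1 with h | h
  · left; ext; rw [coe_secondHalf, max_eq_right (by linarith)]; rfl
  · right; ext; rw [coe_firstHalf, min_eq_right h]; rfl

theorem coe_firstHalf_add_coe_secondHalf (t : I) :
    (firstHalf t : ℝ) + secondHalf t = 2 * (t : ℝ) := by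
  rw [coe_firstHalf, coe_secondHalf]
  rcases le_total (2 * (t : ℝ)) 1 with h | h
  · rw [min_eq_left h, max_eq_right (by linarith)]; ring
  · rw [min_eq_right h, max_eq_left (by linarith)]; ring

@[simp] theorem firstHalf_zero : firstHalf 0 = 0 := by ext; rw [coe_firstHalf]; simp
@[simp] theorem secondHalf_zero : secondHalf 0 = 0 := by ext; rw [coe_secondHalf]; simp
@[simp] theorem firstHalf_one : firstHalf 1 = 1 := by ext; rw [coe_firstHalf]; norm_num
@[simp] theorem secondHalf_one : secondHalf 1 = 1 := by ext; rw [coe_secondHalf]; norm_num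

/-- The concatenation of two paths, each run at double speed: for paths that start at `0` it is
`f (2t)` for `t ≤ 1/2`, and `f 1 + g (2t - 1)` for `t ≥ 1/2`. -/
noncomputable def glue (p : C(I, ℝ) × C(I, ℝ)) : C(I, ℝ) :=
  p.1.comp ⟨firstHalf, continuous_firstHalf⟩ + p.2.comp ⟨secondHalf, continuous_secondHalf⟩

theorem glue_apply (p : C(I, ℝ) × C(I, ℝ)) (t : I) :
    glue p t = p.1 (firstHalf t) + p.2 (secondHalf t) := rfl

@[fun_prop]
theorem continuous_glue : Continuous glue := by
  unfold glue
  have h1 := ContinuousMap.continuous_precomp (Z := ℝ) ⟨firstHalf, continuous_firstHalf⟩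
  have h2 := ContinuousMap.continuous_precomp (Z := ℝ) ⟨secondHalf, continuous_secondHalf⟩
  exact (h1.comp continuous_fst).add (h2.comp continuous_snd)

theorem smul_glue (c : ℝ) (f g : C(I, ℝ)) : c • glue (f, g) = glue (c • f, c • g) := by
  ext t; simp [glue_apply, mul_add]

theorem glue_sub (f g f' g' : C(I, ℝ)) :
    glue (f, g) - glue (f', g') = glue (f - f', g - g') := by
  ext t; simp [glue_apply]; ring

theorem glue_add (f g f' g' : C(I, ℝ)) :
    glue (f, g) + glue (f', g') = glue (f + f', g + g') := by
  ext t; simp [glue_apply]; ring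

theorem glue_zero (p : C(I, ℝ) × C(I, ℝ)) : glue p 0 = p.1 0 + p.2 0 := by
  simp [glue_apply]

theorem glue_one (p : C(I, ℝ) × C(I, ℝ)) : glue p 1 = p.1 1 + p.2 1 := by
  simp [glue_apply]

theorem norm_glue_le (f g : C(I, ℝ)) (hg : g 0 = 0) :
    ‖glue (f, g)‖ ≤ max ‖f‖ ‖g‖ + |f 1| := by
  rw [ContinuousMap.norm_le _ (by positivity)]
  intro t
  rw [glue_apply]
  have h0 : (0 : ℝ) ≤ |f 1| := abs_nonneg _
  rcases halves_cases t with h | h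
  · simp only [h, hg, add_zero]
    linarith [f.norm_coe_le_norm (firstHalf t), le_max_left ‖f‖ ‖g‖]
  · simp only [h]
    have := norm_add_le (f 1) (g (secondHalf t))
    rw [Real.norm_eq_abs (f 1)] at this
    linarith [g.norm_coe_le_norm (secondHalf t), le_max_right ‖f‖ ‖g‖]

/-- The fourth power of a sum is dominated by a multiple, less than `2`, of that of one term:
this lets the recursion for the uniform norm contract. -/
theorem add_pow_four_le (a b : ℝ) (ha : 0 ≤ a) (hb : 0 ≤ b) :
    (a + b) ^ 4 ≤ 3 / 2 * a ^ 4 + 512 * b ^ 4 := by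
  have h := (convexOn_pow (𝕜 := ℝ) 4).2 (show 8 / 7 * a ∈ Set.Ici 0 from Set.mem_Ici.2 (by positivity))
    (show 8 * b ∈ Set.Ici 0 from Set.mem_Ici.2 (by positivity))
    (show (0 : ℝ) ≤ 7 / 8 by norm_num) (show (0 : ℝ) ≤ 1 / 8 by norm_num) (by norm_num)
  simp only [smul_eq_mul] at h
  have e : 7 / 8 * (8 / 7 * a) + 1 / 8 * (8 * b) = a + b := by ring
  rw [e] at h
  have : 0 ≤ a ^ 4 := by positivity
  nlinarith

theorem norm_glue_pow_four_le (f g : C(I, ℝ)) (hg : g 0 = 0) :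
    ‖glue (f, g)‖ ^ 4 ≤ 3 / 2 * (‖f‖ ^ 4 + ‖g‖ ^ 4) + 512 * (f 1) ^ 4 := by
  have h1 : ‖glue (f, g)‖ ^ 4 ≤ (max ‖f‖ ‖g‖ + |f 1|) ^ 4 :=
    pow_le_pow_left₀ (norm_nonneg _) (norm_glue_le f g hg) 4
  have h2 := add_pow_four_le (max ‖f‖ ‖g‖) |f 1| (by positivity) (by positivity)
  have h3 : |f 1| ^ 4 = (f 1) ^ 4 := by rw [← abs_pow, abs_of_nonneg (by positivity)]
  have h4 : (max ‖f‖ ‖g‖) ^ 4 ≤ ‖f‖ ^ 4 + ‖g‖ ^ 4 := by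
    rcases max_choice ‖f‖ ‖g‖ with h | h <;> rw [h]
    · linarith [pow_nonneg (norm_nonneg g) 4]
    · linarith [pow_nonneg (norm_nonneg f) 4]
  rw [h3] at h2
  linarith

/-- If the first path returns to `0`, concatenation does not add up norms. -/
theorem norm_glue_pow_four_le_of_bridge (f g : C(I, ℝ)) (hg : g 0 = 0) (hf : f 1 = 0) :
    ‖glue (f, g)‖ ^ 4 ≤ ‖f‖ ^ 4 + ‖g‖ ^ 4 := by
  have h1 := norm_glue_le f g hg
  rw [hf, abs_zero, add_zero] at h1
  refine (pow_le_pow_left₀ (norm_nonneg _) h1 4).trans ?_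
  rcases max_choice ‖f‖ ‖g‖ with h | h <;> rw [h]
  · linarith [pow_nonneg (norm_nonneg g) 4]
  · linarith [pow_nonneg (norm_nonneg f) 4]

/-- The straight path `t ↦ t`. -/
noncomputable def line : C(I, ℝ) := ⟨fun t => (t : ℝ), continuous_subtype_val⟩

@[simp] theorem line_apply (t : I) : line t = (t : ℝ) := rfl

theorem glue_line : glue (line, line) = (2 : ℝ) • line := by
  ext t; simp [glue_apply, coe_firstHalf_add_coe_secondHalf]

theorem norm_line_le : ‖line‖ ≤ 1 := by
  rw [ContinuousMap.norm_le _ zero_le_one]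
  intro t
  rw [line_apply, Real.norm_eq_abs, abs_of_nonneg t.2.1]
  exact t.2.2

/-! ### Piecewise linear interpolation -/

/-- The point `t / 2`. -/
noncomputable def leftPoint (t : I) : I :=
  ⟨(t : ℝ) / 2, by have := t.2.1; linarith, by have := t.2.2; linarith⟩

/-- The point `(t + 1) / 2`. -/
noncomputable def rightPoint (t : I) : I :=
  ⟨((t : ℝ) + 1) / 2, by have := t.2.1; linarith, by have := t.2.2; linarith⟩

@[fun_prop]
theorem continuous_leftPoint : Continuous leftPoint :=
  Continuous.subtype_mk (by fun_prop) _

@[fun_prop]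
theorem continuous_rightPoint : Continuous rightPoint :=
  Continuous.subtype_mk (by fun_prop) _

@[simp] theorem firstHalf_leftPoint (t : I) : firstHalf (leftPoint t) = t := by
  have := t.2.2
  ext
  rw [coe_firstHalf, leftPoint, min_eq_left (by dsimp only; linarith)]
  dsimp only
  ring

@[simp] theorem secondHalf_leftPoint (t : I) : secondHalf (leftPoint t) = 0 := by
  have := t.2.2
  ext
  rw [coe_secondHalf, leftPoint, max_eq_right (by dsimp only; linarith)]
  rfl

@[simp] theorem firstHalf_rightPoint (t : I) : firstHalf (rightPoint t) = 1 := by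
  have := t.2.1
  ext
  rw [coe_firstHalf, rightPoint, min_eq_right (by dsimp only; linarith)]
  rfl

@[simp] theorem secondHalf_rightPoint (t : I) : secondHalf (rightPoint t) = t := by
  have := t.2.1
  ext
  rw [coe_secondHalf, rightPoint, max_eq_left (by dsimp only; linarith)]
  dsimp only
  ring

@[simp] theorem leftPoint_zero : leftPoint 0 = 0 := by ext; simp [leftPoint]
@[simp] theorem rightPoint_one : rightPoint 1 = 1 := by ext; norm_num [rightPoint]
theorem leftPoint_one : leftPoint 1 = rightPoint 0 := by ext; simp [leftPoint, rightPoint]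

/-- The first half of a path, run at half speed. -/
noncomputable def leftPart (f : C(I, ℝ)) : C(I, ℝ) :=
  f.comp ⟨leftPoint, continuous_leftPoint⟩

/-- The increments of a path over the second half, run at half speed. -/
noncomputable def rightPart (f : C(I, ℝ)) : C(I, ℝ) :=
  f.comp ⟨rightPoint, continuous_rightPoint⟩ - ContinuousMap.const I (f (rightPoint 0))

theorem leftPart_apply (f : C(I, ℝ)) (t : I) : leftPart f t = f (leftPoint t) := rfl

theorem rightPart_apply (f : C(I, ℝ)) (t : I) :
    rightPart f t = f (rightPoint t) - f (rightPoint 0) := rfl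

/-- The piecewise linear interpolation of a path (started at `0`) along the dyadic points of
level `N`. -/
noncomputable def interp : ℕ → C(I, ℝ) → C(I, ℝ)
  | 0, f => f 1 • line
  | N + 1, f => glue (interp N (leftPart f), interp N (rightPart f))

theorem leftPart_glue (f g : C(I, ℝ)) (hg : g 0 = 0) : leftPart (glue (f, g)) = f := by
  ext t; simp [leftPart_apply, glue_apply, hg]

theorem rightPart_glue (f g : C(I, ℝ)) (hg : g 0 = 0) : rightPart (glue (f, g)) = g := by
  ext t; simp [rightPart_apply, glue_apply, hg]

theorem interp_succ_glue (N : ℕ) (f g : C(I, ℝ)) (hg : g 0 = 0) :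
    interp (N + 1) (glue (f, g)) = glue (interp N f, interp N g) := by
  rw [interp, leftPart_glue f g hg, rightPart_glue f g hg]

@[fun_prop]
theorem continuous_leftPart : Continuous leftPart :=
  ContinuousMap.continuous_precomp _

@[fun_prop]
theorem continuous_rightPart : Continuous rightPart := by
  refine (ContinuousMap.continuous_precomp _).sub ?_
  have h : Continuous (ContinuousMap.const I : ℝ → C(I, ℝ)) := ContinuousMap.continuous_const'
  exact h.comp (continuous_eval_const (F := C(I, ℝ)) (rightPoint 0))

@[fun_prop]
theorem continuous_interp (N : ℕ) : Continuous (interp N) := by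
  induction N with
  | zero => exact (continuous_eval_const (F := C(I, ℝ)) (1 : I)).smul continuous_const
  | succ N ih =>
    exact continuous_glue.comp
      ((ih.comp continuous_leftPart).prodMk (ih.comp continuous_rightPart))

theorem leftPart_smul (c : ℝ) (f : C(I, ℝ)) : leftPart (c • f) = c • leftPart f := by
  ext t; simp [leftPart_apply]

theorem rightPart_smul (c : ℝ) (f : C(I, ℝ)) : rightPart (c • f) = c • rightPart f := by
  ext t; simp [rightPart_apply, mul_sub]

theorem interp_smul (N : ℕ) (c : ℝ) (f : C(I, ℝ)) : interp N (c • f) = c • interp N f := by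
  induction N generalizing f with
  | zero => simp [interp, mul_smul]
  | succ N ih => rw [interp, leftPart_smul, rightPart_smul, ih, ih, interp, smul_glue]

theorem interp_apply_zero (N : ℕ) (f : C(I, ℝ)) : interp N f 0 = 0 := by
  induction N generalizing f with
  | zero => simp [interp]
  | succ N ih => rw [interp, glue_zero]; simp [ih]

theorem interp_apply_one (N : ℕ) (f : C(I, ℝ)) (hf : f 0 = 0) : interp N f 1 = f 1 := by
  induction N generalizing f with
  | zero => simp [interp]
  | succ N ih =>
    rw [interp, glue_one, ih _ (by simp [leftPart_apply, hf]), ih _ (by simp [rightPart_apply])]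
    simp [rightPart_apply, leftPart_apply, leftPoint_one]

/-! ### The recursion for the approximations -/

theorem word_succ_of_lt (n k : ℕ) (hk : k < 2 ^ n) : word (n + 1) k = false :: word n k := by
  rw [word, List.ofFn_succ, word]
  congr 1
  · simpa using Nat.testBit_lt_two_pow hk
  · congr 1
    ext i
    congr 1
    simp only [Fin.val_succ]
    omega

theorem word_succ_two_pow_add (n k : ℕ) (hk : k < 2 ^ n) :
    word (n + 1) (2 ^ n + k) = true :: word n k := by
  rw [word, List.ofFn_succ, word]
  congr 1
  · simpa using (Nat.testBit_two_pow_add_eq k n).trans (by simp [Nat.testBit_lt_two_pow hk])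
  · congr 1
    ext i
    have hi := i.2
    have e : n + 1 - 1 - (i.succ : Fin (n + 1)).val = n - 1 - i := by
      simp only [Fin.val_succ]; omega
    rw [e]
    exact Nat.testBit_two_pow_add_gt (by omega) k

theorem pathSign_succ (e : List Bool → ℝ) (n k l : ℕ) (b : Bool)
    (h : word (n + 1) k = b :: word n l) :
    pathSign e (n + 1) k = e [b] * pathSign (fun w => e (b :: w)) n l := by
  rw [pathSign, h, Finset.prod_range_succ', pathSign, mul_comm]
  simp

/-- The approximations are self-similar: the path of level `n + 1` is the concatenation of the
paths of level `n` of the two subtrees, multiplied with the signs of their roots. -/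
theorem approx_succ (H : ℝ) (e : List Bool → ℝ) (n : ℕ) :
    approx H e (n + 1) = glue (((2 : ℝ) ^ (-H) * e [false]) • approx H (fun w => e (false :: w)) n,
      ((2 : ℝ) ^ (-H) * e [true]) • approx H (fun w => e (true :: w)) n) := by
  ext t
  rw [glue_apply]
  change approxFun H e (n + 1) t = ((2 : ℝ) ^ (-H) * e [false]) * approxFun H _ n _ +
    ((2 : ℝ) ^ (-H) * e [true]) * approxFun H _ n _
  rw [approxFun_eq_sum, approxFun_eq_sum, approxFun_eq_sum, pow_succ, mul_two,
    Finset.sum_range_add]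
  have hp : (2 : ℝ) ^ (-(((n + 1 : ℕ) : ℝ) * H)) = 2 ^ (-H) * 2 ^ (-((n : ℝ) * H)) := by
    rw [← Real.rpow_add two_pos]; push_cast; ring_nf
  have ht0 := t.2.1
  have h1 : ∑ k ∈ Finset.range (2 ^ n),
      pathSign e (n + 1) k * max 0 (min 1 (2 ^ (n + 1) * (t : ℝ) - k)) =
      e [false] * ∑ k ∈ Finset.range (2 ^ n), pathSign (fun w => e (false :: w)) n k *
        max 0 (min 1 (2 ^ n * (firstHalf t : ℝ) - k)) := by
    rw [Finset.mul_sum]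
    refine Finset.sum_congr rfl fun k hk => ?_
    have hk := Finset.mem_range.1 hk
    have hk' : (k : ℝ) + 1 ≤ 2 ^ n := by exact_mod_cast hk
    rw [pathSign_succ e n k k false (word_succ_of_lt n k hk), mul_assoc, coe_firstHalf]
    congr 3
    rcases le_total (2 * (t : ℝ)) 1 with h | h
    · rw [min_eq_left h]; ring_nf
    · rw [min_eq_right h, min_eq_left, min_eq_left (by linarith)]
      have := mul_le_mul_of_nonneg_left h (show (0 : ℝ) ≤ 2 ^ n by positivity)
      rw [pow_succ]
      linarith
  have h2 : ∑ k ∈ Finset.range (2 ^ n), pathSign e (n + 1) (2 ^ n + k) *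
        max 0 (min 1 (2 ^ (n + 1) * (t : ℝ) - ((2 ^ n + k : ℕ) : ℝ))) =
      e [true] * ∑ k ∈ Finset.range (2 ^ n), pathSign (fun w => e (true :: w)) n k *
        max 0 (min 1 (2 ^ n * (secondHalf t : ℝ) - k)) := by
    rw [Finset.mul_sum]
    refine Finset.sum_congr rfl fun k hk => ?_
    have hk := Finset.mem_range.1 hk
    have hk0 : (0 : ℝ) ≤ k := Nat.cast_nonneg k
    rw [pathSign_succ e n _ k true (word_succ_two_pow_add n k hk), mul_assoc, coe_secondHalf]
    congr 2
    push_cast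
    rcases le_total (2 * (t : ℝ)) 1 with h | h
    · rw [max_eq_right (show 2 * (t : ℝ) - 1 ≤ 0 by linarith), max_eq_left, max_eq_left]
      · exact min_le_of_right_le (by linarith)
      · refine min_le_of_right_le ?_
        have := mul_le_mul_of_nonneg_left h (show (0 : ℝ) ≤ 2 ^ n by positivity)
        rw [pow_succ]
        linarith
    · rw [max_eq_left (show 0 ≤ 2 * (t : ℝ) - 1 by linarith)]; ring_nf
  rw [h1, h2, hp]
  ring

theorem approx_zero (H : ℝ) (e : List Bool → ℝ) : approx H e 0 = line := by
  ext t
  change approxFun H e 0 t = t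
  rw [approxFun_eq_sum]
  simp [pathSign, t.2.1, t.2.2]

theorem measurable_approx (H : ℝ) (n : ℕ) : Measurable fun e => approx H e n := by
  induction n with
  | zero => simp only [approx_zero]; exact measurable_const
  | succ n ih =>
    simp only [approx_succ]
    have hs : ∀ b, Measurable fun e : List Bool → ℝ => fun w => e (b :: w) := fun b =>
      measurable_pi_lambda _ fun w => measurable_pi_apply _
    refine continuous_glue.measurable.comp (Measurable.prodMk ?_ ?_)
    · exact ((measurable_pi_apply _).const_mul _).smul (ih.comp (hs false))
    · exact ((measurable_pi_apply _).const_mul _).smul (ih.comp (hs true))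

/-! ### Independent labels on the binary tree -/

/-- The law of a family of independent labels of law `ν`, indexed by the words. -/
noncomputable def treeLaw (ν : Measure ℝ) [IsProbabilityMeasure ν] : Measure (List Bool → ℝ) :=
  Measure.infinitePi fun _ => ν

instance (ν : Measure ℝ) [IsProbabilityMeasure ν] : IsProbabilityMeasure (treeLaw ν) := by
  unfold treeLaw; infer_instance

/-- The labels of the subtree whose root is the child `b` of the root. -/
def subtree (b : Bool) (e : List Bool → ℝ) : List Bool → ℝ := fun w => e (b :: w)

/-- The labelled tree with a given root label and given subtrees. -/
def joinTree (p : ℝ × ((List Bool → ℝ) × (List Bool → ℝ))) : List Bool → ℝ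
  | [] => p.1
  | false :: w => p.2.1 w
  | true :: w => p.2.2 w

@[fun_prop]
theorem measurable_subtree (b : Bool) : Measurable (subtree b) :=
  measurable_pi_lambda _ fun _ => measurable_pi_apply _

@[fun_prop]
theorem measurable_joinTree : Measurable joinTree := by
  refine measurable_pi_lambda _ fun w => ?_
  match w with
  | [] => exact measurable_fst
  | false :: w => exact (measurable_pi_apply w).comp (measurable_fst.comp measurable_snd)
  | true :: w => exact (measurable_pi_apply w).comp (measurable_snd.comp measurable_snd)

theorem map_joinTree (ν : Measure ℝ) [IsProbabilityMeasure ν] :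
    (ν.prod ((treeLaw ν).prod (treeLaw ν))).map joinTree = treeLaw ν := by
  classical
  refine Measure.eq_infinitePi _ fun s t ht => ?_
  have hinj : ∀ b : Bool, Function.Injective (List.cons b) := fun b => List.cons_injective
  let s' : Bool → Finset (List Bool) := fun b => s.preimage (List.cons b) (hinj b).injOn
  let A : Set ℝ := if [] ∈ s then t [] else Set.univ
  have hpre : joinTree ⁻¹' (Set.pi s t) = A ×ˢ ((Set.pi (s' false) fun w => t (false :: w)) ×ˢ
      (Set.pi (s' true) fun w => t (true :: w))) := by
    ext ⟨x, f, g⟩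
    simp only [Set.mem_preimage, Set.mem_pi, Set.mem_prod, Finset.mem_coe, s',
      Finset.mem_preimage, A]
    constructor
    · intro h
      refine ⟨?_, fun w hw => h _ hw, fun w hw => h _ hw⟩
      split_ifs with h0
      · exact h _ h0
      · trivial
    · rintro ⟨h0, h1, h2⟩ w hw
      match w with
      | [] => rw [if_pos hw] at h0; exact h0
      | false :: w => exact h1 w hw
      | true :: w => exact h2 w hw
  have hm : ∀ b, MeasurableSet (Set.pi (s' b) fun w => t (b :: w)) := fun b =>
    MeasurableSet.pi (Finset.countable_toSet _) fun w _ => ht _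
  rw [Measure.map_apply measurable_joinTree
    (MeasurableSet.pi (Finset.countable_toSet _) fun w _ => ht _), hpre, Measure.prod_prod,
    Measure.prod_prod, treeLaw, Measure.infinitePi_pi _ fun w _ => ht _,
    Measure.infinitePi_pi _ fun w _ => ht _]
  have hA : ν A = ∏ w ∈ s with w = [], ν (t w) := by
    rw [Finset.prod_filter, Finset.prod_ite_eq']
    simp only [A]
    split_ifs <;> simp
  have hb : ∀ b, ∏ w ∈ s' b, ν (t (b :: w)) = ∏ w ∈ s with w ∈ Set.range (List.cons b), ν (t w) :=
    fun b => Finset.prod_preimage' (List.cons b) s _ fun w => ν (t w)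
  rw [hA, hb, hb, ← Finset.prod_filter_mul_prod_filter_not s (fun w => w = []),
    ← Finset.prod_filter_mul_prod_filter_not (s.filter fun w => ¬ w = [])
      (fun w => w ∈ Set.range (List.cons false)), Finset.filter_filter, Finset.filter_filter]
  congr 3 <;> ext w <;> rcases w with _ | ⟨_ | _, w⟩ <;> simp

/-- The root label and the two subtrees are independent. -/
theorem map_root_subtrees (ν : Measure ℝ) [IsProbabilityMeasure ν] :
    (treeLaw ν).map (fun e => (e [], (subtree false e, subtree true e))) =
      ν.prod ((treeLaw ν).prod (treeLaw ν)) := by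
  nth_rw 1 [← map_joinTree ν]
  rw [Measure.map_map (by fun_prop) measurable_joinTree]
  exact Measure.map_id

theorem map_subtrees (ν : Measure ℝ) [IsProbabilityMeasure ν] :
    (treeLaw ν).map (fun e => (subtree false e, subtree true e)) =
      (treeLaw ν).prod (treeLaw ν) := by
  have h := congrArg (Measure.map Prod.snd) (map_root_subtrees ν)
  rw [Measure.map_map measurable_snd (by fun_prop)] at h
  rw [Measure.map_snd_prod, measure_univ, one_smul] at h
  exact h

/-- A function of the labels that does not depend on the label of the root. -/
def RootFree {β : Type*} (Z : (List Bool → ℝ) → β) : Prop :=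
  ∀ e e' : List Bool → ℝ, (∀ b w, e (b :: w) = e' (b :: w)) → Z e = Z e'

theorem map_root_prod {β : Type*} [MeasurableSpace β] (ν : Measure ℝ) [IsProbabilityMeasure ν]
    {Z : (List Bool → ℝ) → β} (hZ : Measurable Z) (hr : RootFree Z) :
    (treeLaw ν).map (fun e => (e [], Z e)) = ν.prod ((treeLaw ν).map Z) := by
  have hZ' : Measurable fun p : (List Bool → ℝ) × (List Bool → ℝ) => Z (joinTree (0, p)) := by
    fun_prop
  have e1 : ∀ e, Z e = Z (joinTree (0, (subtree false e, subtree true e))) := fun e =>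
    hr _ _ (by rintro (_ | _) w <;> rfl)
  have e2 : (treeLaw ν).map Z = ((treeLaw ν).prod (treeLaw ν)).map fun p => Z (joinTree (0, p)) := by
    rw [← map_subtrees, Measure.map_map hZ' (by fun_prop)]
    congr 1
    exact funext e1
  have e3 := Measure.map_prod_map ν ((treeLaw ν).prod (treeLaw ν)) measurable_id hZ'
  rw [Measure.map_id] at e3
  rw [e2, e3, ← map_root_subtrees, Measure.map_map (by fun_prop) (by fun_prop)]
  congr 1
  funext e
  simp [← e1]

/-! ### The grafting operation on laws of paths -/

/-- The law of `x • f`, for `x` of law `ν` and an independent path `f` of law `μ`. -/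
noncomputable def scaleLaw (ν : Measure ℝ) (μ : Measure C(I, ℝ)) : Measure C(I, ℝ) :=
  (ν.prod μ).map fun p => p.1 • p.2

/-- The law of the concatenation of `x • f` and `y • g`, for independent `x`, `y` of law `ν` and
`f`, `g` of law `μ`. -/
noncomputable def graftLaw (ν : Measure ℝ) (μ : Measure C(I, ℝ)) : Measure C(I, ℝ) :=
  ((scaleLaw ν μ).prod (scaleLaw ν μ)).map glue

instance (ν : Measure ℝ) (μ : Measure C(I, ℝ)) [IsProbabilityMeasure ν] [IsProbabilityMeasure μ] :
    IsProbabilityMeasure (scaleLaw ν μ) :=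
  Measure.isProbabilityMeasure_map (by fun_prop)

instance (ν : Measure ℝ) (μ : Measure C(I, ℝ)) [IsProbabilityMeasure ν] [IsProbabilityMeasure μ] :
    IsProbabilityMeasure (graftLaw ν μ) :=
  Measure.isProbabilityMeasure_map continuous_glue.measurable.aemeasurable

/-- One step of a cascade: concatenate the paths of the two subtrees, each multiplied with the
label of its root and with `h`. -/
noncomputable def graftStep (h : ℝ) (Z : (List Bool → ℝ) → C(I, ℝ)) (e : List Bool → ℝ) : C(I, ℝ) :=
  glue ((h * e [false]) • Z (subtree false e), (h * e [true]) • Z (subtree true e))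

theorem rootFree_graftStep (h : ℝ) (Z : (List Bool → ℝ) → C(I, ℝ)) : RootFree (graftStep h Z) := by
  intro e e' he
  have hs : ∀ b, subtree b e = subtree b e' := fun b => funext (he b)
  simp only [graftStep, hs, he]

theorem map_graftStep (ν : Measure ℝ) [IsProbabilityMeasure ν] (h : ℝ)
    {Z : (List Bool → ℝ) → C(I, ℝ)} (hZ : Measurable Z) (hr : RootFree Z) :
    (treeLaw ν).map (graftStep h Z) = graftLaw (ν.map (h * ·)) ((treeLaw ν).map Z) := by
  have hm : Measurable fun e : List Bool → ℝ => (h * e []) • Z e :=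
    ((measurable_pi_apply _).const_mul _).smul hZ
  have e1 : (treeLaw ν).map (fun e => (h * e []) • Z e) =
      scaleLaw (ν.map (h * ·)) ((treeLaw ν).map Z) := by
    have : IsProbabilityMeasure ((treeLaw ν).map Z) :=
      Measure.isProbabilityMeasure_map hZ.aemeasurable
    rw [scaleLaw, ← Measure.map_id (μ := (treeLaw ν).map Z),
      Measure.map_prod_map _ _ (by fun_prop) measurable_id, ← map_root_prod ν hZ hr,
      Measure.map_map (by fun_prop) (by fun_prop), Measure.map_map (by fun_prop) (by fun_prop)]
    rfl
  rw [graftLaw, ← e1, Measure.map_prod_map _ _ hm hm, ← map_subtrees,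
    Measure.map_map continuous_glue.measurable (hm.prodMap hm),
    Measure.map_map (continuous_glue.measurable.comp (hm.prodMap hm)) (by fun_prop)]
  rfl

theorem approx_succ_eq_graftStep (H : ℝ) (n : ℕ) :
    (fun e => approx H e (n + 1)) = graftStep ((2 : ℝ) ^ (-H)) fun e => approx H e n :=
  funext fun e => approx_succ H e n

theorem rootFree_approx (H : ℝ) (n : ℕ) : RootFree fun e => approx H e n := by
  cases n with
  | zero => intro e e' _; simp only [approx_zero]
  | succ n => rw [approx_succ_eq_graftStep]; exact rootFree_graftStep _ _

theorem smul_graftStep (c h : ℝ) (Z : (List Bool → ℝ) → C(I, ℝ)) :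
    (fun e => c • graftStep h Z e) = graftStep h fun e => c • Z e := by
  funext e
  simp only [graftStep, smul_glue, smul_comm c]

theorem graftStep_sub (h : ℝ) (Z Z' : (List Bool → ℝ) → C(I, ℝ)) :
    (fun e => graftStep h Z e - graftStep h Z' e) = graftStep h fun e => Z e - Z' e := by
  funext e
  simp only [graftStep, glue_sub, smul_sub]

/-! ### Continuity of grafting for weak convergence -/

/-- `graftLaw` as an operation on probability measures. -/
noncomputable def graftProb (ν : ProbabilityMeasure ℝ) (μ : ProbabilityMeasure C(I, ℝ)) :
    ProbabilityMeasure C(I, ℝ) :=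
  ⟨graftLaw ν μ, inferInstance⟩

theorem continuous_graftProb :
    Continuous fun p : ProbabilityMeasure ℝ × ProbabilityMeasure C(I, ℝ) => graftProb p.1 p.2 := by
  have hs : Continuous fun q : ℝ × C(I, ℝ) => q.1 • q.2 := by fun_prop
  have h1 : Continuous fun p : ProbabilityMeasure ℝ × ProbabilityMeasure C(I, ℝ) =>
      (p.1.prod p.2).map hs.measurable.aemeasurable :=
    (ProbabilityMeasure.continuous_map hs).comp ProbabilityMeasure.continuous_prod
  have h2 := (ProbabilityMeasure.continuous_map continuous_glue).comp
    (ProbabilityMeasure.continuous_prod.comp (h1.prodMk h1))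
  exact h2

/-! ### Finitely supported laws of paths -/

/-- The law on `ℝ` with mass `p` at `a` and mass `1 - p` at `-a`. -/
noncomputable def twoPoint (p : I) (a : ℝ) : Measure ℝ :=
  ENNReal.ofReal p • Measure.dirac a + ENNReal.ofReal (1 - p) • Measure.dirac (-a)

instance (p : I) (a : ℝ) : IsProbabilityMeasure (twoPoint p a) := by
  constructor
  simp only [twoPoint, Measure.add_apply, Measure.smul_apply, measure_univ, smul_eq_mul, mul_one]
  rw [← ENNReal.ofReal_add p.2.1 (by linarith [p.2.2])]
  simp

theorem map_mul_twoPoint (p : I) (a h : ℝ) : (twoPoint p a).map (h * ·) = twoPoint p (h * a) := by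
  rw [twoPoint, Measure.map_add _ _ (by fun_prop), Measure.map_smul, Measure.map_smul,
    Measure.map_dirac' (by fun_prop), Measure.map_dirac' (by fun_prop), twoPoint, mul_neg]

theorem scaleLaw_twoPoint (p : I) (h : ℝ) (μ : Measure C(I, ℝ)) [IsProbabilityMeasure μ] :
    scaleLaw (twoPoint p h) μ = ENNReal.ofReal p • μ.map (fun f => h • f) +
      ENNReal.ofReal (1 - p) • μ.map (fun f => (-h) • f) := by
  rw [scaleLaw, twoPoint, Measure.add_prod, Measure.prod_smul_left, Measure.prod_smul_left,
    Measure.dirac_prod, Measure.dirac_prod, Measure.map_add _ _ (by fun_prop), Measure.map_smul,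
    Measure.map_smul, Measure.map_map (by fun_prop) (by fun_prop),
    Measure.map_map (by fun_prop) (by fun_prop)]
  rfl

/-- A law concentrated on finitely many paths, all of which start at `0`. -/
def IsFinitePathLaw (μ : Measure C(I, ℝ)) : Prop :=
  ∃ s : Set C(I, ℝ), s.Finite ∧ (∀ f ∈ s, f 0 = 0) ∧ ∀ᵐ f ∂μ, f ∈ s

theorem IsFinitePathLaw.ae_apply_zero {μ : Measure C(I, ℝ)} (hμ : IsFinitePathLaw μ) :
    ∀ᵐ f ∂μ, f 0 = 0 := by
  obtain ⟨s, -, h0, h⟩ := hμ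
  exact h.mono h0

theorem IsFinitePathLaw.integrable {μ : Measure C(I, ℝ)} [IsFiniteMeasure μ]
    (hμ : IsFinitePathLaw μ) {F : C(I, ℝ) → ℝ} (hF : Measurable F) : Integrable F μ := by
  obtain ⟨s, hs, -, h⟩ := hμ
  obtain ⟨C, hC⟩ := (hs.image fun f => ‖F f‖).bddAbove
  exact Integrable.of_bound hF.aestronglyMeasurable C
    (h.mono fun f hf => hC (Set.mem_image_of_mem _ hf))

theorem ae_map_mem {α β : Type*} [MeasurableSpace α] [MeasurableSpace β] {μ : Measure α}
    {f : α → β} (hf : Measurable f) {s : Set β} (hs : MeasurableSet s) (h : ∀ᵐ x ∂μ, f x ∈ s) :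
    ∀ᵐ y ∂μ.map f, y ∈ s :=
  (ae_map_iff hf.aemeasurable hs).2 h

theorem IsFinitePathLaw.scaleLaw {μ : Measure C(I, ℝ)} [IsProbabilityMeasure μ]
    (hμ : IsFinitePathLaw μ) (p : I) (h : ℝ) : IsFinitePathLaw (scaleLaw (twoPoint p h) μ) := by
  obtain ⟨s, hs, h0, hae⟩ := hμ
  refine ⟨(fun f => h • f) '' s ∪ (fun f => (-h) • f) '' s, (hs.image _).union (hs.image _), ?_, ?_⟩
  · rintro _ (⟨f, hf, rfl⟩ | ⟨f, hf, rfl⟩) <;> simp [h0 f hf]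
  · have hm : MeasurableSet ((fun f : C(I, ℝ) => h • f) '' s ∪ (fun f => (-h) • f) '' s) :=
      ((hs.image _).union (hs.image _)).measurableSet
    rw [scaleLaw_twoPoint, ae_add_measure_iff]
    constructor
    · refine Measure.ae_smul_measure ?_ _
      refine ae_map_mem (by fun_prop) hm (hae.mono fun f hf => Or.inl (Set.mem_image_of_mem _ hf))
    · refine Measure.ae_smul_measure ?_ _
      refine ae_map_mem (by fun_prop) hm (hae.mono fun f hf => Or.inr (Set.mem_image_of_mem _ hf))

theorem ae_prod_of_ae {α β : Type*} [MeasurableSpace α] [MeasurableSpace β] {μ : Measure α}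
    {ν : Measure β} [SFinite μ] [SFinite ν] {P : α → Prop} {Q : β → Prop}
    (hP : ∀ᵐ x ∂μ, P x) (hQ : ∀ᵐ y ∂ν, Q y) : ∀ᵐ z ∂μ.prod ν, P z.1 ∧ Q z.2 :=
  (Measure.quasiMeasurePreserving_fst.ae hP).and (Measure.quasiMeasurePreserving_snd.ae hQ)

theorem IsFinitePathLaw.map_glue {μ : Measure C(I, ℝ)} [IsProbabilityMeasure μ]
    (hμ : IsFinitePathLaw μ) : IsFinitePathLaw ((μ.prod μ).map glue) := by
  obtain ⟨s, hs, h0, hae⟩ := hμ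
  refine ⟨glue '' (s ×ˢ s), (hs.prod hs).image _, ?_, ?_⟩
  · rintro _ ⟨⟨f, g⟩, ⟨hf, hg⟩, rfl⟩
    rw [glue_zero, h0 f hf, h0 g hg, add_zero]
  · refine ae_map_mem continuous_glue.measurable ((hs.prod hs).image _).measurableSet ?_
    exact (ae_prod_of_ae hae hae).mono fun q hq => Set.mem_image_of_mem _ hq

theorem IsFinitePathLaw.graftLaw {μ : Measure C(I, ℝ)} [IsProbabilityMeasure μ]
    (hμ : IsFinitePathLaw μ) (p : I) (h : ℝ) : IsFinitePathLaw (graftLaw (twoPoint p h) μ) :=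
  (hμ.scaleLaw p h).map_glue

theorem IsFinitePathLaw.integrable_prod {μ : Measure C(I, ℝ)} [IsProbabilityMeasure μ]
    (hμ : IsFinitePathLaw μ) {F : C(I, ℝ) × C(I, ℝ) → ℝ} (hF : Measurable F) :
    Integrable F (μ.prod μ) := by
  obtain ⟨s, hs, -, h⟩ := hμ
  obtain ⟨C, hC⟩ := ((hs.prod hs).image fun q => ‖F q‖).bddAbove
  exact Integrable.of_bound hF.aestronglyMeasurable C
    ((ae_prod_of_ae h h).mono fun q hq => hC (Set.mem_image_of_mem _ hq))

theorem integral_scaleLaw {μ : Measure C(I, ℝ)} [IsProbabilityMeasure μ]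
    (hμ : IsFinitePathLaw μ) (p : I) (h : ℝ) {F : C(I, ℝ) → ℝ} (hF : Measurable F) :
    ∫ f, F f ∂(scaleLaw (twoPoint p h) μ) =
      p * ∫ f, F (h • f) ∂μ + (1 - p) * ∫ f, F ((-h) • f) ∂μ := by
  have h1 : Integrable F (μ.map fun f => h • f) :=
    (integrable_map_measure hF.aestronglyMeasurable (by fun_prop)).2
      (hμ.integrable (hF.comp (by fun_prop)))
  have h2 : Integrable F (μ.map fun f => (-h) • f) :=
    (integrable_map_measure hF.aestronglyMeasurable (by fun_prop)).2
      (hμ.integrable (hF.comp (by fun_prop)))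
  rw [scaleLaw_twoPoint, integral_add_measure (h1.smul_measure ENNReal.ofReal_ne_top)
      (h2.smul_measure ENNReal.ofReal_ne_top), integral_smul_measure, integral_smul_measure,
    integral_map (by fun_prop) hF.aestronglyMeasurable,
    integral_map (by fun_prop) hF.aestronglyMeasurable,
    ENNReal.toReal_ofReal p.2.1, ENNReal.toReal_ofReal (by linarith [p.2.2]), smul_eq_mul,
    smul_eq_mul]

/-! ### Moments of the endpoint -/

/-- The `k`-th moment of the endpoint of a random path. -/
noncomputable def moment1 (k : ℕ) (μ : Measure C(I, ℝ)) : ℝ := ∫ f, (f 1) ^ k ∂μ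

@[fun_prop]
theorem measurable_eval (t : I) : Measurable fun f : C(I, ℝ) => f t :=
  (continuous_eval_const (F := C(I, ℝ)) t).measurable

theorem moment1_scaleLaw {μ : Measure C(I, ℝ)} [IsProbabilityMeasure μ]
    (hμ : IsFinitePathLaw μ) (p : I) (h : ℝ) (k : ℕ) :
    moment1 k (scaleLaw (twoPoint p h) μ) = (p + (1 - p) * (-1) ^ k) * h ^ k * moment1 k μ := by
  rw [moment1, integral_scaleLaw hμ p h (by fun_prop)]
  simp only [ContinuousMap.coe_smul, Pi.smul_apply, smul_eq_mul, mul_pow, integral_const_mul]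
  rw [neg_pow h k, moment1]
  ring

theorem integral_pow_mul_pow {μ : Measure C(I, ℝ)} [IsProbabilityMeasure μ] (j k : ℕ) :
    ∫ q, (q.1 1) ^ j * (q.2 1) ^ k ∂(μ.prod μ) = moment1 j μ * moment1 k μ :=
  integral_prod_mul (fun f : C(I, ℝ) => (f 1) ^ j) fun f : C(I, ℝ) => (f 1) ^ k

theorem moment1_one_map_glue {μ : Measure C(I, ℝ)} [IsProbabilityMeasure μ]
    (hμ : IsFinitePathLaw μ) : moment1 1 ((μ.prod μ).map glue) = 2 * moment1 1 μ := by
  have hi : ∀ j k : ℕ, Integrable (fun q : C(I, ℝ) × C(I, ℝ) => (q.1 1) ^ j * (q.2 1) ^ k)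
      (μ.prod μ) := fun j k => hμ.integrable_prod (by fun_prop)
  rw [moment1, integral_map continuous_glue.measurable.aemeasurable
    (Measurable.aestronglyMeasurable (by fun_prop))]
  have e : ∀ q : C(I, ℝ) × C(I, ℝ), (glue q 1) ^ 1 =
      (q.1 1) ^ 1 * (q.2 1) ^ 0 + (q.1 1) ^ 0 * (q.2 1) ^ 1 := by
    intro q; rw [glue_one]; ring
  simp_rw [e]
  rw [integral_add (hi _ _) (hi _ _), integral_pow_mul_pow, integral_pow_mul_pow]
  simp [moment1]
  ring

theorem moment1_two_map_glue {μ : Measure C(I, ℝ)} [IsProbabilityMeasure μ]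
    (hμ : IsFinitePathLaw μ) :
    moment1 2 ((μ.prod μ).map glue) = 2 * moment1 2 μ + 2 * moment1 1 μ ^ 2 := by
  have h0 : moment1 0 μ = 1 := by simp [moment1]
  rw [moment1, integral_map continuous_glue.measurable.aemeasurable
    (Measurable.aestronglyMeasurable (by fun_prop))]
  have e : ∀ q : C(I, ℝ) × C(I, ℝ), (glue q 1) ^ 2 =
      (q.1 1) ^ 2 * (q.2 1) ^ 0 + 2 * ((q.1 1) ^ 1 * (q.2 1) ^ 1) + (q.1 1) ^ 0 * (q.2 1) ^ 2 := by
    intro q; rw [glue_one]; ring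
  simp_rw [e]
  rw [integral_add, integral_add, integral_const_mul]
  · simp only [integral_pow_mul_pow, h0]
    ring
  all_goals exact hμ.integrable_prod (by fun_prop)

theorem moment1_four_map_glue {μ : Measure C(I, ℝ)} [IsProbabilityMeasure μ]
    (hμ : IsFinitePathLaw μ) :
    moment1 4 ((μ.prod μ).map glue) =
      2 * moment1 4 μ + 8 * (moment1 3 μ * moment1 1 μ) + 6 * moment1 2 μ ^ 2 := by
  have h0 : moment1 0 μ = 1 := by simp [moment1]
  rw [moment1, integral_map continuous_glue.measurable.aemeasurable
    (Measurable.aestronglyMeasurable (by fun_prop))]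
  have e : ∀ q : C(I, ℝ) × C(I, ℝ), (glue q 1) ^ 4 =
      (q.1 1) ^ 4 * (q.2 1) ^ 0 + 4 * ((q.1 1) ^ 3 * (q.2 1) ^ 1) + 6 * ((q.1 1) ^ 2 * (q.2 1) ^ 2)
        + 4 * ((q.1 1) ^ 1 * (q.2 1) ^ 3) + (q.1 1) ^ 0 * (q.2 1) ^ 4 := by
    intro q; rw [glue_one]; ring
  simp_rw [e]
  rw [integral_add, integral_add, integral_add, integral_add, integral_const_mul,
    integral_const_mul, integral_const_mul]
  · simp only [integral_pow_mul_pow, h0]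
    ring
  all_goals exact hμ.integrable_prod (by fun_prop)

/-! ### Fourth moments of norms -/

/-- A function on paths that is homogeneous of degree `4` scales by `h ^ 4`. -/
theorem integral_scaleLaw_of_homogeneous {μ : Measure C(I, ℝ)} [IsProbabilityMeasure μ]
    (hμ : IsFinitePathLaw μ) (p : I) (h : ℝ) {F : C(I, ℝ) → ℝ} (hF : Measurable F)
    (hF4 : ∀ c f, F (c • f) = c ^ 4 * F f) :
    ∫ f, F f ∂(scaleLaw (twoPoint p h) μ) = h ^ 4 * ∫ f, F f ∂μ := by
  rw [integral_scaleLaw hμ p h hF]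
  simp only [hF4, integral_const_mul]
  ring

theorem integral_fst_prod {μ : Measure C(I, ℝ)} [IsProbabilityMeasure μ] (F : C(I, ℝ) → ℝ) :
    ∫ q, F q.1 ∂(μ.prod μ) = ∫ f, F f ∂μ := by
  simpa using integral_prod_mul (μ := μ) (ν := μ) F (fun _ => (1 : ℝ))

theorem integral_snd_prod {μ : Measure C(I, ℝ)} [IsProbabilityMeasure μ] (F : C(I, ℝ) → ℝ) :
    ∫ q, F q.2 ∂(μ.prod μ) = ∫ f, F f ∂μ := by
  simpa using integral_prod_mul (μ := μ) (ν := μ) (fun _ => (1 : ℝ)) F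

theorem integral_norm_pow_four_map_glue_le {μ : Measure C(I, ℝ)} [IsProbabilityMeasure μ]
    (hμ : IsFinitePathLaw μ) :
    ∫ f, ‖f‖ ^ 4 ∂((μ.prod μ).map glue) ≤ 3 * ∫ f, ‖f‖ ^ 4 ∂μ + 512 * moment1 4 μ := by
  rw [integral_map continuous_glue.measurable.aemeasurable
    (Measurable.aestronglyMeasurable (by fun_prop))]
  have h1 : ∫ q : C(I, ℝ) × C(I, ℝ), ‖glue q‖ ^ 4 ∂(μ.prod μ) ≤
      ∫ q, (3 / 2 * (‖q.1‖ ^ 4 + ‖q.2‖ ^ 4) + 512 * (q.1 1) ^ 4) ∂(μ.prod μ) := by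
    refine integral_mono_ae (hμ.integrable_prod ?_) (hμ.integrable_prod (by fun_prop)) ?_
    · exact (continuous_glue.norm.pow 4).measurable
    · filter_upwards [ae_prod_of_ae hμ.ae_apply_zero hμ.ae_apply_zero] with q hq
      exact norm_glue_pow_four_le q.1 q.2 hq.2
  refine h1.trans_eq ?_
  rw [integral_add, integral_const_mul, integral_add, integral_const_mul,
    integral_fst_prod fun f => ‖f‖ ^ 4, integral_snd_prod fun f => ‖f‖ ^ 4,
    integral_fst_prod fun f => (f 1) ^ 4, moment1]
  · ring
  all_goals exact hμ.integrable_prod (by fun_prop)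

theorem integral_interp_error_map_glue_le {μ : Measure C(I, ℝ)} [IsProbabilityMeasure μ]
    (hμ : IsFinitePathLaw μ) (N : ℕ) :
    ∫ f, ‖f - interp (N + 1) f‖ ^ 4 ∂((μ.prod μ).map glue) ≤
      2 * ∫ f, ‖f - interp N f‖ ^ 4 ∂μ := by
  rw [integral_map continuous_glue.measurable.aemeasurable
    (Continuous.aestronglyMeasurable (by fun_prop))]
  have h1 : ∫ q : C(I, ℝ) × C(I, ℝ), ‖glue q - interp (N + 1) (glue q)‖ ^ 4 ∂(μ.prod μ) ≤
      ∫ q, (‖q.1 - interp N q.1‖ ^ 4 + ‖q.2 - interp N q.2‖ ^ 4) ∂(μ.prod μ) := by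
    refine integral_mono_ae (hμ.integrable_prod (Continuous.measurable (by fun_prop)))
      (hμ.integrable_prod (Continuous.measurable (by fun_prop))) ?_
    filter_upwards [ae_prod_of_ae hμ.ae_apply_zero hμ.ae_apply_zero] with q hq
    rw [interp_succ_glue N q.1 q.2 hq.2]
    change ‖glue (q.1, q.2) - _‖ ^ 4 ≤ _
    rw [glue_sub]
    refine norm_glue_pow_four_le_of_bridge _ _ ?_ ?_
    · simp [hq.2, interp_apply_zero]
    · simp [interp_apply_one N q.1 hq.1]
  refine h1.trans_eq ?_
  rw [integral_add, integral_fst_prod fun f => ‖f - interp N f‖ ^ 4,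
    integral_snd_prod fun f => ‖f - interp N f‖ ^ 4]
  · ring
  all_goals exact hμ.integrable_prod (Continuous.measurable (by fun_prop))

/-! ### Parameters of the cascade -/

/-- The probability `(1 + 2^{H-1})/2` of the sign `1`, clipped to `[0,1]`. -/
noncomputable def signProb (H : ℝ) : I :=
  Set.projIcc 0 1 zero_le_one ((1 + (2 : ℝ) ^ (H - 1)) / 2)

/-- The law of `2^{-H} ε` for a sign `ε` of the cascade. -/
noncomputable def stepLaw (H : ℝ) : Measure ℝ := twoPoint (signProb H) ((2 : ℝ) ^ (-H))

instance (H : ℝ) : IsProbabilityMeasure (stepLaw H) := by unfold stepLaw; infer_instance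

theorem coe_signProb {H : ℝ} (hH : H ≤ 1) : (signProb H : ℝ) = (1 + (2 : ℝ) ^ (H - 1)) / 2 := by
  have h1 : (2 : ℝ) ^ (H - 1) ≤ 1 := Real.rpow_le_one_of_one_le_of_nonpos one_le_two (by linarith)
  have h2 : 0 < (2 : ℝ) ^ (H - 1) := by positivity
  rw [signProb, Set.projIcc_of_mem]
  constructor <;> linarith

/-- A sign of mean `2^{H-1}`, multiplied with `2^{-H}`, has mean `1/2`: this makes the total mass
of the cascade a martingale. -/
theorem signProb_mul_scale {H : ℝ} (hH : H ≤ 1) :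
    (signProb H + (1 - signProb H) * (-1) : ℝ) * (2 : ℝ) ^ (-H) = 1 / 2 := by
  rw [coe_signProb hH]
  have : (2 : ℝ) ^ (H - 1) * 2 ^ (-H) = 1 / 2 := by
    rw [← Real.rpow_add two_pos, show H - 1 + -H = -1 by ring, Real.rpow_neg_one]; norm_num
  linear_combination this

theorem scale_sq_lt {H : ℝ} (hH : 1 / 2 < H) : ((2 : ℝ) ^ (-H)) ^ 2 < 1 / 2 := by
  have h : ((2 : ℝ) ^ (-H)) ^ 2 = 2 ^ (-(2 * H)) := by
    rw [← Real.rpow_natCast, ← Real.rpow_mul two_pos.le]; push_cast; ring_nf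
  rw [h, show (1 / 2 : ℝ) = 2 ^ (-1 : ℝ) by rw [Real.rpow_neg_one]; norm_num]
  exact Real.rpow_lt_rpow_of_exponent_lt one_lt_two (by linarith)

theorem inv_sigma_sq {H : ℝ} (hH : 1 / 2 < H) :
    (sigma H)⁻¹ ^ 2 = 2 - 4 * ((2 : ℝ) ^ (-H)) ^ 2 := by
  have h : (2 : ℝ) ^ (2 - 2 * H) = 4 * ((2 : ℝ) ^ (-H)) ^ 2 := by
    rw [sub_eq_add_neg, Real.rpow_add two_pos, ← Real.rpow_natCast ((2 : ℝ) ^ (-H)),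
      ← Real.rpow_mul two_pos.le]
    push_cast
    rw [show -H * 2 = -(2 * H) by ring]
    norm_num
  have h0 : 0 ≤ 2 - 4 * ((2 : ℝ) ^ (-H)) ^ 2 := by linarith [scale_sq_lt hH]
  rw [sigma, h, ← Real.rpow_neg h0, ← Real.rpow_natCast, ← Real.rpow_mul h0]
  norm_num

theorem inv_sigma_nonneg (H : ℝ) (hH : 1 / 2 < H) : 0 ≤ (sigma H)⁻¹ := by
  rw [sigma]
  have h0 : (2 : ℝ) ^ (2 - 2 * H) ≤ 2 ^ (1 : ℝ) :=
    Real.rpow_le_rpow_of_exponent_le one_le_two (by linarith)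
  rw [Real.rpow_one] at h0
  exact inv_nonneg.2 (Real.rpow_nonneg (by linarith) _)

theorem inv_sigma_le_one {H : ℝ} (hH : 1 / 2 < H) (hH1 : H < 1) : (sigma H)⁻¹ ^ 2 ≤ 1 := by
  rw [inv_sigma_sq hH]
  have : (1 / 2 : ℝ) ≤ 2 ^ (-H) := by
    rw [show (1 / 2 : ℝ) = 2 ^ (-1 : ℝ) by rw [Real.rpow_neg_one]; norm_num]
    exact Real.rpow_le_rpow_of_exponent_le one_le_two (by linarith)
  nlinarith

/-! ### Moments along the recursion -/

section Recursion

variable {H : ℝ} {μ : Measure C(I, ℝ)} [IsProbabilityMeasure μ]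

theorem moment1_one_graftLaw (hH : H ≤ 1) (hμ : IsFinitePathLaw μ) :
    moment1 1 (graftLaw (stepLaw H) μ) = moment1 1 μ := by
  have h := signProb_mul_scale hH
  rw [stepLaw, graftLaw, moment1_one_map_glue (hμ.scaleLaw _ _), moment1_scaleLaw hμ, pow_one,
    pow_one, h]
  ring

theorem moment1_two_graftLaw (hH : H ≤ 1) (hμ : IsFinitePathLaw μ) :
    moment1 2 (graftLaw (stepLaw H) μ) =
      2 * ((2 : ℝ) ^ (-H)) ^ 2 * moment1 2 μ + moment1 1 μ ^ 2 / 2 := by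
  have h := signProb_mul_scale hH
  rw [stepLaw, graftLaw, moment1_two_map_glue (hμ.scaleLaw _ _), moment1_scaleLaw hμ,
    moment1_scaleLaw hμ, pow_one, pow_one, h]
  ring

theorem moment1_four_graftLaw (hH : H ≤ 1) (hμ : IsFinitePathLaw μ) :
    moment1 4 (graftLaw (stepLaw H) μ) = 2 * ((2 : ℝ) ^ (-H)) ^ 4 * moment1 4 μ +
      2 * ((2 : ℝ) ^ (-H)) ^ 2 * (moment1 3 μ * moment1 1 μ) +
      6 * ((2 : ℝ) ^ (-H)) ^ 4 * moment1 2 μ ^ 2 := by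
  have h := signProb_mul_scale hH
  rw [stepLaw, graftLaw, moment1_four_map_glue (hμ.scaleLaw _ _), moment1_scaleLaw hμ,
    moment1_scaleLaw hμ, moment1_scaleLaw hμ, moment1_scaleLaw hμ, pow_one, pow_one, h]
  have h3 : (signProb H + (1 - signProb H) * (-1) ^ 3 : ℝ) * ((2 : ℝ) ^ (-H)) ^ 3 =
      1 / 2 * ((2 : ℝ) ^ (-H)) ^ 2 := by rw [← h]; ring
  rw [h3]
  ring

theorem norm_graftLaw_le (hμ : IsFinitePathLaw μ) :
    ∫ f, ‖f‖ ^ 4 ∂(graftLaw (stepLaw H) μ) ≤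
      ((2 : ℝ) ^ (-H)) ^ 4 * (3 * ∫ f, ‖f‖ ^ 4 ∂μ + 512 * moment1 4 μ) := by
  rw [stepLaw, graftLaw]
  refine (integral_norm_pow_four_map_glue_le (hμ.scaleLaw _ _)).trans_eq ?_
  rw [integral_scaleLaw_of_homogeneous hμ _ _ (by fun_prop)
    (fun c f => by rw [norm_smul, mul_pow, Real.norm_eq_abs, ← abs_pow,
      abs_of_nonneg (show 0 ≤ c ^ 4 by positivity)]), moment1_scaleLaw hμ]
  ring

theorem interp_error_graftLaw_le (hμ : IsFinitePathLaw μ) (N : ℕ) :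
    ∫ f, ‖f - interp (N + 1) f‖ ^ 4 ∂(graftLaw (stepLaw H) μ) ≤
      2 * ((2 : ℝ) ^ (-H)) ^ 4 * ∫ f, ‖f - interp N f‖ ^ 4 ∂μ := by
  rw [stepLaw, graftLaw]
  refine (integral_interp_error_map_glue_le (hμ.scaleLaw _ _) N).trans_eq ?_
  rw [integral_scaleLaw_of_homogeneous hμ _ _ (Continuous.measurable (by fun_prop))
    (fun c f => by rw [interp_smul, ← smul_sub, norm_smul, mul_pow, Real.norm_eq_abs, ← abs_pow,
      abs_of_nonneg (show 0 ≤ c ^ 4 by positivity)])]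
  ring

end Recursion

/-- The law obtained from `μ` by `n` generations of grafting. -/
noncomputable def iterLaw (H : ℝ) (μ : Measure C(I, ℝ)) : ℕ → Measure C(I, ℝ)
  | 0 => μ
  | n + 1 => graftLaw (stepLaw H) (iterLaw H μ n)

instance (H : ℝ) (μ : Measure C(I, ℝ)) [IsProbabilityMeasure μ] (n : ℕ) :
    IsProbabilityMeasure (iterLaw H μ n) := by
  induction n with
  | zero => assumption
  | succ n ih => unfold iterLaw; infer_instance

theorem IsFinitePathLaw.iterLaw {μ : Measure C(I, ℝ)} [IsProbabilityMeasure μ]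
    (hμ : IsFinitePathLaw μ) (H : ℝ) (n : ℕ) : IsFinitePathLaw (iterLaw H μ n) := by
  induction n with
  | zero => exact hμ
  | succ n ih => exact ih.graftLaw _ _

theorem moment1_one_iterLaw {H : ℝ} (hH : H ≤ 1) {μ : Measure C(I, ℝ)} [IsProbabilityMeasure μ]
    (hμ : IsFinitePathLaw μ) (n : ℕ) : moment1 1 (iterLaw H μ n) = moment1 1 μ := by
  induction n with
  | zero => rfl
  | succ n ih => rw [iterLaw, moment1_one_graftLaw hH (hμ.iterLaw H n), ih]

/-- For a law with centred endpoint, the fourth moments of the uniform norm decay geometrically. -/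
theorem exists_norm_iterLaw_le {H : ℝ} (hH : H ≤ 1) {μ : Measure C(I, ℝ)} [IsProbabilityMeasure μ]
    (hμ : IsFinitePathLaw μ) (h1 : moment1 1 μ = 0) :
    ∃ K, 0 ≤ K ∧ ∀ n, ∫ f, ‖f‖ ^ 4 ∂(iterLaw H μ n) ≤ K * (4 * ((2 : ℝ) ^ (-H)) ^ 4) ^ n := by
  set h : ℝ := (2 : ℝ) ^ (-H) with hh
  have h4 : (0 : ℝ) ≤ h ^ 4 := by positivity
  have h2n : ∀ n, moment1 2 (iterLaw H μ n) = moment1 2 μ * (2 * h ^ 2) ^ n := by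
    intro n
    induction n with
    | zero => simp [iterLaw]
    | succ n ih =>
      rw [iterLaw, moment1_two_graftLaw hH (hμ.iterLaw H n), ih, moment1_one_iterLaw hH hμ, h1]
      ring
  obtain ⟨A, hA, hA'⟩ : ∃ A, moment1 4 μ ≤ A ∧ 3 * moment1 2 μ ^ 2 ≤ A :=
    ⟨max _ _, le_max_left _ _, le_max_right _ _⟩
  have hA0 : 0 ≤ A := le_trans (by positivity) hA'
  have h4n : ∀ n, moment1 4 (iterLaw H μ n) ≤ A * (4 * h ^ 4) ^ n := by
    intro n
    induction n with
    | zero => simpa [iterLaw] using hA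
    | succ n ih =>
      rw [iterLaw, moment1_four_graftLaw hH (hμ.iterLaw H n), h2n, moment1_one_iterLaw hH hμ, h1,
        mul_pow, ← pow_mul, mul_comm n 2, pow_mul, show (2 * h ^ 2) ^ 2 = 4 * h ^ 4 by ring,
        pow_succ (4 * h ^ 4), ← hh]
      have hp : 0 ≤ (4 * h ^ 4) ^ n := by positivity
      have e1 := mul_le_mul_of_nonneg_left ih (mul_nonneg zero_le_two h4)
      have e2 := mul_le_mul_of_nonneg_right hA' (mul_nonneg h4 hp)
      nlinarith
  refine ⟨max (∫ f, ‖f‖ ^ 4 ∂μ) (512 * A), le_max_of_le_right (by positivity), fun n => ?_⟩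
  set K := max (∫ f, ‖f‖ ^ 4 ∂μ) (512 * A) with hK
  induction n with
  | zero => simp [iterLaw, hK]
  | succ n ih =>
    refine (norm_graftLaw_le (hμ.iterLaw H n)).trans ?_
    rw [pow_succ, ← hh]
    have hp : 0 ≤ (4 * h ^ 4) ^ n := by positivity
    have e0 : 512 * A ≤ K := le_max_right _ _
    have e1 := mul_le_mul_of_nonneg_right e0 hp
    have e2 : 3 * ∫ f, ‖f‖ ^ 4 ∂(iterLaw H μ n) + 512 * moment1 4 (iterLaw H μ n) ≤
        4 * (K * (4 * h ^ 4) ^ n) := by linarith [h4n n]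
    calc h ^ 4 * _ ≤ h ^ 4 * (4 * (K * (4 * h ^ 4) ^ n)) := mul_le_mul_of_nonneg_left e2 h4
      _ = _ := by ring

/-! ### Almost sure summability -/

/-- Geometrically decaying fourth moments imply almost sure summability. -/
theorem ae_summable_norm {Ω E : Type*} [MeasurableSpace Ω] {P : Measure Ω} [IsProbabilityMeasure P]
    [NormedAddCommGroup E] [MeasurableSpace E] [OpensMeasurableSpace E] {d : ℕ → Ω → E}
    (hd : ∀ n, Measurable (d n)) {K s : ℝ} (hK : 0 ≤ K) (hs0 : 0 < s) (hs1 : s < 1)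
    (hb : ∀ n, ∫⁻ ω, ENNReal.ofReal (‖d n ω‖ ^ 4) ∂P ≤ ENNReal.ofReal (K * (s ^ 4) ^ n)) :
    ∀ᵐ ω ∂P, Summable fun n => ‖d n ω‖ := by
  have h1 : ∀ n, ∫⁻ ω, ENNReal.ofReal ‖d n ω‖ ∂P ≤ ENNReal.ofReal ((1 + K) * s ^ n) := by
    intro n
    have hsn : 0 < s ^ n := by positivity
    -- `a ≤ u + a⁴ / u³` for every `u > 0`
    have hpt : ∀ ω, ENNReal.ofReal ‖d n ω‖ ≤
        ENNReal.ofReal (s ^ n) + ENNReal.ofReal ((s ^ n)⁻¹ ^ 3) * ENNReal.ofReal (‖d n ω‖ ^ 4) := by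
      intro ω
      rw [← ENNReal.ofReal_mul (by positivity), ← ENNReal.ofReal_add (by positivity)
        (by positivity)]
      refine ENNReal.ofReal_le_ofReal ?_
      set a := ‖d n ω‖
      have ha : 0 ≤ a := norm_nonneg _
      rcases le_total a (s ^ n) with h | h
      · have : 0 ≤ (s ^ n)⁻¹ ^ 3 * a ^ 4 := by positivity
        linarith
      · have h3 : 1 ≤ (s ^ n)⁻¹ ^ 3 * a ^ 3 := by
          rw [← mul_pow, inv_mul_eq_div]
          exact one_le_pow₀ ((one_le_div hsn).2 h)
        have := mul_le_mul_of_nonneg_right h3 ha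
        have e : (s ^ n)⁻¹ ^ 3 * a ^ 4 = (s ^ n)⁻¹ ^ 3 * a ^ 3 * a := by ring
        rw [e]
        linarith
    calc ∫⁻ ω, ENNReal.ofReal ‖d n ω‖ ∂P
        ≤ ∫⁻ ω, (ENNReal.ofReal (s ^ n) +
          ENNReal.ofReal ((s ^ n)⁻¹ ^ 3) * ENNReal.ofReal (‖d n ω‖ ^ 4)) ∂P := lintegral_mono hpt
      _ = ENNReal.ofReal (s ^ n) +
          ENNReal.ofReal ((s ^ n)⁻¹ ^ 3) * ∫⁻ ω, ENNReal.ofReal (‖d n ω‖ ^ 4) ∂P := by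
        rw [lintegral_add_left measurable_const, lintegral_const, measure_univ, mul_one,
          lintegral_const_mul']
        exact ENNReal.ofReal_ne_top
      _ ≤ ENNReal.ofReal (s ^ n) +
          ENNReal.ofReal ((s ^ n)⁻¹ ^ 3) * ENNReal.ofReal (K * (s ^ 4) ^ n) := by
        gcongr; exact hb n
      _ = ENNReal.ofReal ((1 + K) * s ^ n) := by
        rw [← ENNReal.ofReal_mul (by positivity), ← ENNReal.ofReal_add (by positivity)
          (by positivity)]
        congr 1
        have : (s ^ 4) ^ n = (s ^ n) ^ 3 * s ^ n := by ring
        rw [this]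
        field_simp
  have h2 : ∫⁻ ω, ∑' n, ENNReal.ofReal ‖d n ω‖ ∂P ≠ ⊤ := by
    rw [lintegral_tsum fun n => ((hd n).norm.ennreal_ofReal).aemeasurable]
    refine ne_top_of_le_ne_top ?_ (ENNReal.tsum_le_tsum h1)
    have hsum : Summable fun n => (1 + K) * s ^ n :=
      (summable_geometric_of_lt_one hs0.le hs1).mul_left _
    rw [← ENNReal.ofReal_tsum_of_nonneg (fun n => by positivity) hsum]
    exact ENNReal.ofReal_ne_top
  have h3 : Measurable fun ω => ∑' n, ENNReal.ofReal ‖d n ω‖ :=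
    Measurable.tsum fun n => (hd n).norm.ennreal_ofReal
  filter_upwards [ae_lt_top h3 h2] with ω hω
  have := ENNReal.summable_toReal hω.ne
  simpa using this

theorem ae_exists_tendsto {Ω E : Type*} [MeasurableSpace Ω] {P : Measure Ω}
    [NormedAddCommGroup E] [CompleteSpace E] {Y : ℕ → Ω → E}
    (h : ∀ᵐ ω ∂P, Summable fun n => ‖Y (n + 1) ω - Y n ω‖) :
    ∀ᵐ ω ∂P, ∃ f, Tendsto (fun n => Y n ω) atTop (𝓝 f) := by
  filter_upwards [h] with ω hω
  refine cauchySeq_tendsto_of_complete (cauchySeq_of_summable_dist ?_)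
  simpa [dist_eq_norm, norm_sub_rev] using hω

/-! ### Convergence of the cascade -/

/-- The law of a single sign of the cascade. -/
noncomputable def signLaw (H : ℝ) : Measure ℝ := twoPoint (signProb H) 1

instance (H : ℝ) : IsProbabilityMeasure (signLaw H) := by unfold signLaw; infer_instance

theorem map_mul_signLaw (H : ℝ) : (signLaw H).map ((2 : ℝ) ^ (-H) * ·) = stepLaw H := by
  rw [signLaw, map_mul_twoPoint, mul_one, stepLaw]

theorem isFinitePathLaw_dirac {f : C(I, ℝ)} (hf : f 0 = 0) :
    IsFinitePathLaw (Measure.dirac f) := by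
  refine ⟨{f}, Set.finite_singleton f, by simpa using hf, ?_⟩
  rw [ae_dirac_eq]
  exact Set.mem_singleton f

theorem measurable_smul_approx (H c : ℝ) (n : ℕ) : Measurable fun e => c • approx H e n :=
  (continuous_const_smul c).measurable.comp (measurable_approx H n)

theorem map_smul_approx (H c : ℝ) (n : ℕ) :
    (treeLaw (signLaw H)).map (fun e => c • approx H e n) =
      iterLaw H (Measure.dirac (c • line)) n := by
  induction n with
  | zero => simp [approx_zero, iterLaw]
  | succ n ih =>
    have hr : RootFree fun e => c • approx H e n := fun e e' he => by
      simp only [rootFree_approx H n e e' he]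
    have e1 : (fun e => c • approx H e (n + 1)) =
        graftStep ((2 : ℝ) ^ (-H)) fun e => c • approx H e n := by
      rw [← smul_graftStep, ← approx_succ_eq_graftStep]
    rw [e1, map_graftStep _ _ (measurable_smul_approx H c n) hr, map_mul_signLaw, ih,
      iterLaw]

theorem map_approx (H : ℝ) (n : ℕ) :
    (treeLaw (signLaw H)).map (fun e => approx H e n) = iterLaw H (Measure.dirac line) n := by
  simpa using map_smul_approx H 1 n

theorem measurable_approx_sub (H : ℝ) (n : ℕ) :
    Measurable fun e => approx H e (n + 1) - approx H e n :=
  (measurable_approx H (n + 1)).sub (measurable_approx H n)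

/-- The increments of the sequence of approximations obey the recursion of the cascade. -/
theorem map_approx_sub (H : ℝ) (n : ℕ) :
    (treeLaw (signLaw H)).map (fun e => approx H e (n + 1) - approx H e n) =
      iterLaw H ((treeLaw (signLaw H)).map fun e => approx H e 1 - approx H e 0) n := by
  induction n with
  | zero => rfl
  | succ n ih =>
    have hr : RootFree fun e => approx H e (n + 1) - approx H e n := fun e e' he => by
      simp only [rootFree_approx H (n + 1) e e' he, rootFree_approx H n e e' he]
    have e1 : (fun e => approx H e (n + 1 + 1) - approx H e (n + 1)) =
        graftStep ((2 : ℝ) ^ (-H)) fun e => approx H e (n + 1) - approx H e n := by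
      rw [← graftStep_sub]
      funext e
      rw [← approx_succ_eq_graftStep, ← approx_succ_eq_graftStep]
    rw [e1, map_graftStep _ _ (measurable_approx_sub H n) hr, map_mul_signLaw, ih, iterLaw]

theorem IsFinitePathLaw.map_sub_line {μ : Measure C(I, ℝ)} (hμ : IsFinitePathLaw μ) :
    IsFinitePathLaw (μ.map fun f => f - line) := by
  obtain ⟨s, hs, h0, h⟩ := hμ
  refine ⟨(fun f => f - line) '' s, hs.image _, ?_, ?_⟩
  · rintro _ ⟨f, hf, rfl⟩; simp [h0 f hf]
  · exact ae_map_mem (by fun_prop) (hs.image _).measurableSet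
      (h.mono fun f hf => Set.mem_image_of_mem _ hf)

/-- The law of the first increment `B_1 - B_0`. -/
theorem map_approx_one_sub (H : ℝ) :
    (treeLaw (signLaw H)).map (fun e => approx H e 1 - approx H e 0) =
      (graftLaw (stepLaw H) (Measure.dirac line)).map fun f => f - line := by
  have h := map_approx H 1
  rw [iterLaw, iterLaw] at h
  rw [← h, Measure.map_map (by fun_prop) (measurable_approx H 1)]
  simp only [approx_zero]
  rfl

theorem isFinitePathLaw_approx_one_sub (H : ℝ) :
    IsFinitePathLaw ((treeLaw (signLaw H)).map fun e => approx H e 1 - approx H e 0) := by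
  rw [map_approx_one_sub]
  exact ((isFinitePathLaw_dirac (by simp)).graftLaw _ _).map_sub_line

theorem moment1_one_approx_one_sub {H : ℝ} (hH1 : H ≤ 1) :
    moment1 1 ((treeLaw (signLaw H)).map fun e => approx H e 1 - approx H e 0) = 0 := by
  have hl : IsFinitePathLaw (Measure.dirac line) := isFinitePathLaw_dirac (by simp)
  have hg : IsFinitePathLaw (graftLaw (stepLaw H) (Measure.dirac line)) := hl.graftLaw _ _
  have h2 := moment1_one_graftLaw hH1 hl
  rw [moment1, moment1, integral_dirac] at h2
  rw [map_approx_one_sub, moment1,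
    integral_map (by fun_prop) (Measurable.aestronglyMeasurable (by fun_prop))]
  simp only [pow_one, line_apply, ContinuousMap.sub_apply] at h2 ⊢
  rw [integral_sub (hg.integrable (by fun_prop)) (integrable_const _), h2]
  simp

theorem exists_lintegral_approx_sub_le {H : ℝ} (hH1 : H ≤ 1) :
    ∃ K, 0 ≤ K ∧ ∀ n, ∫⁻ e, ENNReal.ofReal (‖approx H e (n + 1) - approx H e n‖ ^ 4)
      ∂(treeLaw (signLaw H)) ≤ ENNReal.ofReal (K * (4 * ((2 : ℝ) ^ (-H)) ^ 4) ^ n) := by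
  have hfin := isFinitePathLaw_approx_one_sub H
  have : IsProbabilityMeasure
      ((treeLaw (signLaw H)).map fun e => approx H e 1 - approx H e 0) :=
    Measure.isProbabilityMeasure_map (measurable_approx_sub H 0).aemeasurable
  obtain ⟨K, hK, hb⟩ := exists_norm_iterLaw_le hH1 hfin (moment1_one_approx_one_sub hH1)
  refine ⟨K, hK, fun n => ?_⟩
  have e1 := hb n
  have hi := (hfin.iterLaw H n).integrable (F := fun f => ‖f‖ ^ 4) (by fun_prop)
  rw [← map_approx_sub] at e1 hi
  rw [integral_map (measurable_approx_sub H n).aemeasurable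
    (Measurable.aestronglyMeasurable (by fun_prop))] at e1
  have hi' : Integrable (fun e => ‖approx H e (n + 1) - approx H e n‖ ^ 4) (treeLaw (signLaw H)) :=
    hi.comp_measurable (measurable_approx_sub H n)
  rw [← ofReal_integral_eq_lintegral_ofReal hi' (ae_of_all _ fun e => by positivity)]
  exact ENNReal.ofReal_le_ofReal e1

theorem ae_tendsto_approx {H : ℝ} (hH : 1 / 2 < H) (hH1 : H ≤ 1) :
    ∀ᵐ e ∂(treeLaw (signLaw H)), Tendsto (approx H e) atTop (𝓝 (limitPath H e)) := by
  obtain ⟨K, hK, hb⟩ := exists_lintegral_approx_sub_le hH1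
  have hsq := scale_sq_lt hH
  have hpos : 0 < (2 : ℝ) ^ (-H) := by positivity
  generalize (2 : ℝ) ^ (-H) = h at *
  have h2 : √2 ^ 2 = 2 := Real.sq_sqrt (by norm_num)
  have hs4 : (√2 * h) ^ 4 = 4 * h ^ 4 := by
    rw [mul_pow, show √2 ^ 4 = (√2 ^ 2) ^ 2 by ring, h2]; norm_num
  have hs1 : √2 * h < 1 := by
    by_contra hcon
    push Not at hcon
    have := one_le_pow₀ hcon (n := 2)
    rw [mul_pow, h2] at this
    linarith
  rw [← hs4] at hb
  have hsum := ae_summable_norm (measurable_approx_sub H) hK (mul_pos (by positivity) hpos) hs1 hb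
  filter_upwards [ae_exists_tendsto (Y := fun n e => approx H e n) hsum] with e he
  exact tendsto_nhds_limUnder he

theorem aemeasurable_limitPath {H : ℝ} (hH : 1 / 2 < H) (hH1 : H ≤ 1) :
    AEMeasurable (limitPath H) (treeLaw (signLaw H)) :=
  aemeasurable_of_tendsto_metrizable_ae atTop (fun n => (measurable_approx H n).aemeasurable)
    (ae_tendsto_approx hH hH1)

theorem aemeasurable_smul_limitPath {H : ℝ} (hH : 1 / 2 < H) (hH1 : H ≤ 1) (c : ℝ) :
    AEMeasurable (fun e => c • limitPath H e) (treeLaw (signLaw H)) :=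
  (continuous_const_smul c).measurable.comp_aemeasurable (aemeasurable_limitPath hH hH1)

/-! ### The normalized limit law -/

/-- The law of `B_n / σ_H`. -/
noncomputable def approxProb (H : ℝ) (n : ℕ) : ProbabilityMeasure C(I, ℝ) :=
  ⟨iterLaw H (Measure.dirac ((sigma H)⁻¹ • line)) n, inferInstance⟩

/-- The law of `B_H / σ_H`. -/
noncomputable def limitProb (H : Set.Ioo (1 / 2 : ℝ) 1) : ProbabilityMeasure C(I, ℝ) :=
  ⟨(treeLaw (signLaw H)).map fun e => (sigma H)⁻¹ • limitPath H e,
    Measure.isProbabilityMeasure_map (aemeasurable_smul_limitPath H.2.1 H.2.2.le _)⟩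

/-- `stepLaw` as a probability measure. -/
noncomputable def stepProb (H : ℝ) : ProbabilityMeasure ℝ := ⟨stepLaw H, inferInstance⟩

theorem isFinitePathLaw_approxProb (H : ℝ) (n : ℕ) :
    IsFinitePathLaw (approxProb H n : Measure C(I, ℝ)) :=
  (isFinitePathLaw_dirac (by simp)).iterLaw H n

theorem approxProb_succ (H : ℝ) (n : ℕ) :
    approxProb H (n + 1) = graftProb (stepProb H) (approxProb H n) := rfl

theorem tendsto_approxProb (H : Set.Ioo (1 / 2 : ℝ) 1) :
    Tendsto (approxProb H) atTop (𝓝 (limitProb H)) := by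
  have h := tendstoInDistribution_of_ae_tendsto (μ' := treeLaw (signLaw H)) (l := atTop)
    (X := fun n e => (sigma H)⁻¹ • approx H e n) (Z := fun e => (sigma H)⁻¹ • limitPath H e)
    (fun n => (measurable_smul_approx H _ n).aemeasurable)
    (aemeasurable_smul_limitPath H.2.1 H.2.2.le _)
    ((ae_tendsto_approx H.2.1 H.2.2.le).mono fun e he => he.const_smul _)
  refine (tendsto_congr fun n => ?_).2 h.tendsto
  exact Subtype.ext (map_smul_approx H _ n).symm

theorem limitProb_eq_graftProb (H : Set.Ioo (1 / 2 : ℝ) 1) :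
    limitProb H = graftProb (stepProb H) (limitProb H) := by
  refine tendsto_nhds_unique ((tendsto_add_atTop_iff_nat 1).2 (tendsto_approxProb H)) ?_
  simp only [approxProb_succ]
  exact (continuous_graftProb.tendsto (stepProb H, limitProb H)).comp
    (tendsto_const_nhds.prodMk_nhds (tendsto_approxProb H))

/-- The law of the interpolation of level `N`. -/
noncomputable def interpProb (N : ℕ) (μ : ProbabilityMeasure C(I, ℝ)) :
    ProbabilityMeasure C(I, ℝ) :=
  μ.map (continuous_interp N).measurable.aemeasurable

theorem continuous_interpProb (N : ℕ) : Continuous (interpProb N) :=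
  ProbabilityMeasure.continuous_map (continuous_interp N)

theorem map_interp_scaleLaw (N : ℕ) (ν : Measure ℝ) (μ : Measure C(I, ℝ)) [IsProbabilityMeasure ν]
    [IsProbabilityMeasure μ] : (scaleLaw ν μ).map (interp N) = scaleLaw ν (μ.map (interp N)) := by
  have hm := (continuous_interp N).measurable
  have e := Measure.map_prod_map ν μ measurable_id hm
  rw [Measure.map_id] at e
  rw [scaleLaw, scaleLaw, e, Measure.map_map hm (by fun_prop),
    Measure.map_map (by fun_prop) (measurable_id.prodMap hm)]
  congr 1
  funext q
  exact interp_smul N q.1 q.2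

theorem map_interp_graftLaw (N : ℕ) (p : I) (h : ℝ) (μ : Measure C(I, ℝ)) [IsProbabilityMeasure μ]
    (hμ : IsFinitePathLaw μ) : (graftLaw (twoPoint p h) μ).map (interp (N + 1)) =
      graftLaw (twoPoint p h) (μ.map (interp N)) := by
  have hm := (continuous_interp N).measurable
  have hs := hμ.scaleLaw p h
  rw [graftLaw, graftLaw, ← map_interp_scaleLaw,
    Measure.map_map (continuous_interp (N + 1)).measurable continuous_glue.measurable,
    Measure.map_prod_map _ _ hm hm, Measure.map_map continuous_glue.measurable (hm.prodMap hm)]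
  refine Measure.map_congr ?_
  filter_upwards [ae_prod_of_ae hs.ae_apply_zero hs.ae_apply_zero] with q hq
  exact interp_succ_glue N q.1 q.2 hq.2

theorem interpProb_succ_limitProb (N : ℕ) (H : Set.Ioo (1 / 2 : ℝ) 1) :
    interpProb (N + 1) (limitProb H) = graftProb (stepProb H) (interpProb N (limitProb H)) := by
  have h1 : ∀ n, interpProb (N + 1) (approxProb H (n + 1)) =
      graftProb (stepProb H) (interpProb N (approxProb H n)) := fun n =>
    Subtype.ext (map_interp_graftLaw N _ _ _ (isFinitePathLaw_approxProb H n))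
  refine tendsto_nhds_unique (((continuous_interpProb (N + 1)).tendsto _).comp
    ((tendsto_add_atTop_iff_nat 1).2 (tendsto_approxProb H))) ?_
  simp only [Function.comp_def, h1]
  exact (continuous_graftProb.tendsto (stepProb H, interpProb N (limitProb H))).comp
    (tendsto_const_nhds.prodMk_nhds
      (((continuous_interpProb N).tendsto _).comp (tendsto_approxProb H)))

/-! ### Uniform moment bounds -/

section Bounds

variable {H : ℝ}

theorem moment1_one_approxProb (hH1 : H < 1) (n : ℕ) :
    moment1 1 (approxProb H n : Measure C(I, ℝ)) = (sigma H)⁻¹ := by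
  refine (moment1_one_iterLaw hH1.le (isFinitePathLaw_dirac (by simp)) n).trans ?_
  simp [moment1]

theorem moment1_two_approxProb (hH : 1 / 2 < H) (hH1 : H < 1) (n : ℕ) :
    moment1 2 (approxProb H n : Measure C(I, ℝ)) =
      1 - (2 * ((2 : ℝ) ^ (-H)) ^ 2) ^ n * (1 - (sigma H)⁻¹ ^ 2) := by
  induction n with
  | zero => simp [approxProb, iterLaw, moment1]
  | succ n ih =>
    have h := moment1_two_graftLaw hH1.le (isFinitePathLaw_approxProb H n)
    rw [ih, moment1_one_approxProb hH1, inv_sigma_sq hH] at h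
    refine h.trans ?_
    rw [inv_sigma_sq hH]
    ring

theorem moment1_two_approxProb_le (hH : 1 / 2 < H) (hH1 : H < 1) (n : ℕ) :
    moment1 2 (approxProb H n : Measure C(I, ℝ)) ≤ 1 := by
  rw [moment1_two_approxProb hH hH1]
  have := inv_sigma_le_one hH hH1
  have : 0 ≤ (2 * ((2 : ℝ) ^ (-H)) ^ 2) ^ n * (1 - (sigma H)⁻¹ ^ 2) :=
    mul_nonneg (by positivity) (by linarith)
  linarith

theorem tendsto_moment1_two_approxProb (hH : 1 / 2 < H) (hH1 : H < 1) :
    Tendsto (fun n => moment1 2 (approxProb H n : Measure C(I, ℝ))) atTop (𝓝 1) := by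
  simp only [moment1_two_approxProb hH hH1]
  have h := tendsto_pow_atTop_nhds_zero_of_lt_one (r := 2 * ((2 : ℝ) ^ (-H)) ^ 2) (by positivity)
    (by linarith [scale_sq_lt hH])
  have h' := (h.mul_const (1 - (sigma H)⁻¹ ^ 2)).const_sub 1
  rwa [zero_mul, sub_zero] at h'

/-- The fourth moments of the normalized endpoints are bounded uniformly in `H`. -/
theorem moment1_four_approxProb_le (hH : 1 / 2 < H) (hH1 : H < 1) (n : ℕ) :
    moment1 4 (approxProb H n : Measure C(I, ℝ)) ≤ 10 := by
  have hc := inv_sigma_le_one hH hH1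
  have hc0 := inv_sigma_nonneg H hH
  have hc1 : (sigma H)⁻¹ ≤ 1 := by nlinarith
  induction n with
  | zero =>
    have : moment1 4 (approxProb H 0 : Measure C(I, ℝ)) = ((sigma H)⁻¹ ^ 2) ^ 2 := by
      simp [approxProb, iterLaw, moment1, ← pow_mul]
    rw [this]
    nlinarith [sq_nonneg ((sigma H)⁻¹)]
  | succ n ih =>
    have h := moment1_four_graftLaw hH1.le (isFinitePathLaw_approxProb H n)
    rw [moment1_one_approxProb hH1] at h
    refine h.le.trans ?_
    have h2 := moment1_two_approxProb_le hH hH1 n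
    have h20 : 0 ≤ moment1 2 (approxProb H n : Measure C(I, ℝ)) :=
      integral_nonneg fun f => sq_nonneg _
    have h40 : 0 ≤ moment1 4 (approxProb H n : Measure C(I, ℝ)) :=
      integral_nonneg fun f => by positivity
    -- `|x|³ ≤ x² + x⁴ / 4`
    have h3 : moment1 3 (approxProb H n : Measure C(I, ℝ)) ≤
        moment1 2 (approxProb H n : Measure C(I, ℝ)) +
          moment1 4 (approxProb H n : Measure C(I, ℝ)) / 4 := by
      have hi : ∀ k : ℕ, Integrable (fun f : C(I, ℝ) => (f 1) ^ k) (approxProb H n : Measure _) :=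
        fun k => (isFinitePathLaw_approxProb H n).integrable (by fun_prop)
      rw [moment1, moment1, moment1, ← integral_div, ← integral_add (hi 2) ((hi 4).div_const 4)]
      refine integral_mono (hi 3) ((hi 2).add ((hi 4).div_const 4)) fun f => ?_
      dsimp only [Pi.add_apply]
      nlinarith [sq_nonneg ((f 1) * (1 - f 1 / 2))]
    have hsq := scale_sq_lt hH
    have ha : 0 ≤ ((2 : ℝ) ^ (-H)) ^ 2 := by positivity
    have hb : ((2 : ℝ) ^ (-H)) ^ 4 ≤ 1 / 4 := by
      rw [show ((2 : ℝ) ^ (-H)) ^ 4 = (((2 : ℝ) ^ (-H)) ^ 2) ^ 2 by ring]; nlinarith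
    have hb0 : 0 ≤ ((2 : ℝ) ^ (-H)) ^ 4 := by positivity
    generalize moment1 2 (approxProb H n : Measure C(I, ℝ)) = m2 at *
    generalize moment1 3 (approxProb H n : Measure C(I, ℝ)) = m3 at *
    generalize moment1 4 (approxProb H n : Measure C(I, ℝ)) = m4 at *
    have e1 : 2 * ((2 : ℝ) ^ (-H)) ^ 4 * m4 ≤ 1 / 2 * m4 :=
      mul_le_mul_of_nonneg_right (by linarith) h40
    have e2 : m3 * (sigma H)⁻¹ ≤ m2 + m4 / 4 := by
      refine (mul_le_mul_of_nonneg_right h3 hc0).trans ?_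
      exact mul_le_of_le_one_right (by positivity) hc1
    have e3 : 2 * ((2 : ℝ) ^ (-H)) ^ 2 * (m3 * (sigma H)⁻¹) ≤ m2 + m4 / 4 := by
      refine (mul_le_mul_of_nonneg_left e2 (by positivity)).trans ?_
      exact mul_le_of_le_one_left (by positivity) (by linarith)
    have e4 : 6 * ((2 : ℝ) ^ (-H)) ^ 4 * m2 ^ 2 ≤ 6 * (1 / 4) * 1 := by
      have : m2 ^ 2 ≤ 1 := pow_le_one₀ h20 h2
      gcongr
    linarith

theorem norm_approxProb_le (hH : 1 / 2 < H) (hH1 : H < 1) (n : ℕ) :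
    ∫ f, ‖f‖ ^ 4 ∂(approxProb H n : Measure C(I, ℝ)) ≤ 5120 := by
  have hb : ((2 : ℝ) ^ (-H)) ^ 4 ≤ 1 / 4 := by
    rw [show ((2 : ℝ) ^ (-H)) ^ 4 = (((2 : ℝ) ^ (-H)) ^ 2) ^ 2 by ring]
    nlinarith [scale_sq_lt hH, sq_nonneg ((2 : ℝ) ^ (-H))]
  induction n with
  | zero =>
    have hc := inv_sigma_le_one hH hH1
    simp only [approxProb, iterLaw, ProbabilityMeasure.coe_mk, integral_dirac]
    have h1 : ‖(sigma H)⁻¹ • line‖ ≤ 1 := by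
      rw [norm_smul, Real.norm_eq_abs, ← sq_abs] at *
      have := norm_line_le
      have h2 : |(sigma H)⁻¹| ≤ 1 := by nlinarith [abs_nonneg (sigma H)⁻¹]
      exact mul_le_one₀ h2 (norm_nonneg _) this
    have := pow_le_one₀ (n := 4) (norm_nonneg _) h1
    linarith
  | succ n ih =>
    refine (norm_graftLaw_le (isFinitePathLaw_approxProb H n)).trans ?_
    have h4 := moment1_four_approxProb_le hH hH1 n
    have : 3 * ∫ f, ‖f‖ ^ 4 ∂(approxProb H n : Measure C(I, ℝ)) +
        512 * moment1 4 (approxProb H n : Measure C(I, ℝ)) ≤ 4 * 5120 := by linarith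
    refine (mul_le_mul_of_nonneg_left this (by positivity)).trans ?_
    linarith

/-- The interpolation error is small, uniformly in `H`. -/
theorem interp_error_approxProb_le (hH : 1 / 2 < H) (hH1 : H < 1) (N n : ℕ) :
    ∫ f, ‖f - interp N f‖ ^ 4 ∂(approxProb H (n + N) : Measure C(I, ℝ)) ≤
      81920 * (1 / 2) ^ N := by
  induction N with
  | zero =>
    have hfin := isFinitePathLaw_approxProb H n
    have hle : ∀ f : C(I, ℝ), ‖f - interp 0 f‖ ^ 4 ≤ 16 * ‖f‖ ^ 4 := by
      intro f
      have h1 : ‖interp 0 f‖ ≤ ‖f‖ := by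
        rw [interp, norm_smul]
        exact (mul_le_of_le_one_right (norm_nonneg _) norm_line_le).trans (f.norm_coe_le_norm 1)
      have h2 : ‖f - interp 0 f‖ ≤ 2 * ‖f‖ := (norm_sub_le _ _).trans (by linarith)
      calc _ ≤ (2 * ‖f‖) ^ 4 := pow_le_pow_left₀ (norm_nonneg _) h2 4
        _ = _ := by ring
    have := integral_mono (hfin.integrable (Continuous.measurable (by fun_prop)))
      (hfin.integrable (by fun_prop)) hle
    rw [integral_const_mul] at this
    rw [pow_zero, mul_one, add_zero]
    linarith [norm_approxProb_le hH hH1 n]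
  | succ N ih =>
    refine (interp_error_graftLaw_le (isFinitePathLaw_approxProb H (n + N)) N).trans ?_
    have hb : 2 * ((2 : ℝ) ^ (-H)) ^ 4 ≤ 1 / 2 := by
      rw [show ((2 : ℝ) ^ (-H)) ^ 4 = (((2 : ℝ) ^ (-H)) ^ 2) ^ 2 by ring]
      nlinarith [scale_sq_lt hH, sq_nonneg ((2 : ℝ) ^ (-H))]
    refine (mul_le_mul hb ih (integral_nonneg fun f => by positivity) (by norm_num)).trans_eq ?_
    ring

end Bounds

/-! ### The characteristic function of the endpoint -/

/-- The characteristic function of the endpoint of a random path. -/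
noncomputable def endChar (μ : Measure C(I, ℝ)) (s : ℝ) : ℂ := charFun (μ.map fun f => f 1) s

theorem endChar_eq (μ : Measure C(I, ℝ)) (s : ℝ) :
    endChar μ s = ∫ f, Complex.exp (s * f 1 * Complex.I) ∂μ := by
  rw [endChar, charFun_apply_real, integral_map (measurable_eval 1).aemeasurable
    (Continuous.aestronglyMeasurable (by fun_prop))]

theorem endChar_map_glue (μ : Measure C(I, ℝ)) [IsProbabilityMeasure μ] (s : ℝ) :
    endChar ((μ.prod μ).map glue) s = endChar μ s ^ 2 := by
  have hc : Continuous fun f : C(I, ℝ) => Complex.exp (s * f 1 * Complex.I) := by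
    have := continuous_eval_const (F := C(I, ℝ)) (1 : I)
    fun_prop
  rw [endChar_eq, integral_map continuous_glue.measurable.aemeasurable hc.aestronglyMeasurable,
    endChar_eq, sq, ← integral_prod_mul]
  congr 1
  funext q
  rw [glue_one, ← Complex.exp_add]
  push_cast
  ring_nf

theorem endChar_scaleLaw_twoPoint (p : I) (h : ℝ) (μ : Measure C(I, ℝ)) [IsProbabilityMeasure μ]
    (s : ℝ) : endChar (scaleLaw (twoPoint p h) μ) s =
      p * endChar μ (h * s) + (1 - p) * (starRingEnd ℂ) (endChar μ (h * s)) := by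
  have hc : Continuous fun f : C(I, ℝ) => Complex.exp (s * f 1 * Complex.I) := by
    have := continuous_eval_const (F := C(I, ℝ)) (1 : I)
    fun_prop
  have hi : ∀ ν : Measure C(I, ℝ), IsFiniteMeasure ν →
      Integrable (fun f : C(I, ℝ) => Complex.exp (s * f 1 * Complex.I)) ν := fun ν _ => by
    refine Integrable.of_bound hc.aestronglyMeasurable 1 (ae_of_all _ fun f => ?_)
    rw [show (s : ℂ) * (f 1 : ℝ) = ((s * f 1 : ℝ) : ℂ) by push_cast; rfl,
      Complex.norm_exp_ofReal_mul_I]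
  have hmap : ∀ c : ℝ, ∫ f, Complex.exp (s * f 1 * Complex.I) ∂(μ.map fun f => c • f) =
      endChar μ (c * s) := fun c => by
    rw [integral_map (by fun_prop) hc.aestronglyMeasurable, endChar_eq]
    congr 1
    funext f
    simp only [ContinuousMap.coe_smul, Pi.smul_apply, smul_eq_mul]
    push_cast
    ring_nf
  rw [endChar_eq, scaleLaw_twoPoint, integral_add_measure
      ((hi _ inferInstance).smul_measure ENNReal.ofReal_ne_top)
      ((hi _ inferInstance).smul_measure ENNReal.ofReal_ne_top),
    integral_smul_measure, integral_smul_measure, hmap, hmap, ENNReal.toReal_ofReal p.2.1,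
    ENNReal.toReal_ofReal (by linarith [p.2.2]), neg_mul]
  nth_rw 2 [endChar]
  rw [charFun_neg, ← endChar, Complex.real_smul, Complex.real_smul]
  push_cast
  rfl

/-- Grafting brings the characteristic function of the endpoint closer to the Gaussian one: the
error at `s` is controlled by the error at `h s`, because mixing a number with its conjugate does
not increase its distance to a real number. -/
theorem norm_endChar_graftLaw_sub_le (p : I) (h : ℝ) (hh : h ^ 2 ≤ 1 / 2) (μ : Measure C(I, ℝ))
    [IsProbabilityMeasure μ] (s : ℝ) :
    ‖endChar (graftLaw (twoPoint p h) μ) s - Real.exp (-(s ^ 2 / 2))‖ ≤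
      2 * ‖endChar μ (h * s) - Real.exp (-((h * s) ^ 2 / 2))‖ + s ^ 2 * (1 / 2 - h ^ 2) := by
  set z := endChar μ (h * s) with hz
  set g := Real.exp (-((h * s) ^ 2 / 2)) with hg
  set v := Real.exp (-(s ^ 2 / 4)) with hv
  have hv2 : Real.exp (-(s ^ 2 / 2)) = v ^ 2 := by
    rw [hv, ← Real.exp_nat_mul]; push_cast; ring_nf
  have hv1 : v ≤ 1 := Real.exp_le_one_iff.2 (by linarith [sq_nonneg s])
  have hv0 : 0 < v := Real.exp_pos _
  set u : ℂ := p * z + (1 - p) * (starRingEnd ℂ) z with hu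
  have hp0 := p.2.1
  have hp1 := p.2.2
  have hz1 : ‖z‖ ≤ 1 := by
    have : IsProbabilityMeasure (μ.map fun f : C(I, ℝ) => f 1) :=
      Measure.isProbabilityMeasure_map (measurable_eval 1).aemeasurable
    rw [hz, endChar]; exact norm_charFun_le_one _
  have hmix : ∀ w : ℂ, ‖p * w + (1 - p) * (starRingEnd ℂ) w‖ ≤ ‖w‖ := fun w => by
    refine (norm_add_le _ _).trans ?_
    rw [show (1 - (p : ℝ) : ℂ) = ((1 - p : ℝ) : ℂ) by push_cast; rfl, norm_mul, norm_mul,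
      Complex.norm_real, Complex.norm_real, RCLike.norm_conj, Real.norm_of_nonneg hp0,
      Real.norm_of_nonneg (by linarith)]
    linarith
  have hu1 : ‖u‖ ≤ 1 := (hmix z).trans hz1
  have hug : ‖u - g‖ ≤ ‖z - g‖ := by
    have : u - g = p * (z - g) + (1 - p) * (starRingEnd ℂ) (z - g) := by
      rw [hu, map_sub, Complex.conj_ofReal]; ring
    rw [this]
    exact hmix _
  have hgv : ‖(g : ℂ) - v‖ ≤ s ^ 2 / 2 * (1 / 2 - h ^ 2) := by
    rw [← Complex.ofReal_sub, Complex.norm_real, Real.norm_eq_abs]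
    have hle : v ≤ g := Real.exp_le_exp.2 (by rw [mul_pow]; nlinarith [sq_nonneg s])
    rw [abs_of_nonneg (by linarith)]
    have hs : 0 ≤ s ^ 2 / 2 * (1 / 2 - h ^ 2) := mul_nonneg (by positivity) (by linarith)
    have e : v = g * Real.exp (-(s ^ 2 / 2 * (1 / 2 - h ^ 2))) := by
      rw [hg, hv, ← Real.exp_add]; ring_nf
    have h1 := Real.add_one_le_exp (-(s ^ 2 / 2 * (1 / 2 - h ^ 2)))
    have h2 : g ≤ 1 := Real.exp_le_one_iff.2 (by nlinarith [sq_nonneg (h * s)])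
    have h3 : 0 < g := Real.exp_pos _
    rw [e]
    nlinarith
  have huv : ‖u - v‖ ≤ ‖z - g‖ + s ^ 2 / 2 * (1 / 2 - h ^ 2) := by
    calc ‖u - v‖ = ‖(u - g) + (g - v)‖ := by ring_nf
      _ ≤ _ := (norm_add_le _ _).trans (add_le_add hug hgv)
  have hsum : ‖u + v‖ ≤ 2 := by
    refine (norm_add_le _ _).trans ?_
    rw [Complex.norm_real, Real.norm_of_nonneg hv0.le]
    linarith
  rw [graftLaw, endChar_map_glue, endChar_scaleLaw_twoPoint, ← hz, ← hu, hv2]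
  push_cast
  rw [show u ^ 2 - (v : ℂ) ^ 2 = (u + v) * (u - v) by ring, norm_mul]
  refine (mul_le_mul hsum huv (norm_nonneg _) zero_le_two).trans ?_
  linarith

theorem norm_exp_sub_taylor_le (x : ℝ) :
    ‖Complex.exp (x * Complex.I) - (1 + x * Complex.I - x ^ 2 / 2)‖ ≤ 4 * |x| ^ 3 := by
  rcases le_total |x| 1 with h | h
  · have h1 := Complex.norm_exp_sub_sum_le_norm_mul_exp (x * Complex.I) 3
    have h2 : ∑ m ∈ Finset.range 3, ((x : ℂ) * Complex.I) ^ m / (m.factorial : ℂ) =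
        1 + x * Complex.I - x ^ 2 / 2 := by
      simp [Finset.sum_range_succ, mul_pow, Nat.factorial]
      ring
    rw [h2, norm_mul, Complex.norm_I, mul_one, Complex.norm_real, Real.norm_eq_abs] at h1
    refine h1.trans ?_
    rw [mul_comm]
    gcongr
    exact (Real.exp_le_exp.2 h).trans (by linarith [Real.exp_one_lt_d9])
  · refine (norm_sub_le _ _).trans ?_
    rw [Complex.norm_exp_ofReal_mul_I]
    have h1 : ‖(1 + x * Complex.I - x ^ 2 / 2 : ℂ)‖ ≤ 1 + |x| + |x| ^ 2 / 2 := by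
      refine (norm_sub_le _ _).trans (add_le_add ((norm_add_le _ _).trans ?_) ?_)
      · simp
      · simp
    have h2 : 1 ≤ |x| ^ 3 := one_le_pow₀ h
    have h3 : |x| ≤ |x| ^ 3 := le_self_pow₀ h (by norm_num)
    have h4 : |x| ^ 2 ≤ |x| ^ 3 := pow_le_pow_right₀ h (by norm_num)
    linarith

/-- Second order expansion of the characteristic function of `B_n(1) / σ_H`, with an error term
that is uniform in `H`. -/
theorem norm_endChar_approxProb_sub_le {H : ℝ} (hH : 1 / 2 < H) (hH1 : H < 1) (n : ℕ) (s : ℝ) :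
    ‖endChar (approxProb H n : Measure C(I, ℝ)) s - (1 + s * (sigma H)⁻¹ * Complex.I -
      s ^ 2 * moment1 2 (approxProb H n : Measure C(I, ℝ)) / 2)‖ ≤ 24 * |s| ^ 3 := by
  have hfin := isFinitePathLaw_approxProb H n
  set μ : Measure C(I, ℝ) := (approxProb H n : Measure C(I, ℝ)) with hμ
  have hm : Measurable fun f : C(I, ℝ) => f 1 := by fun_prop
  have hi1 : Integrable (fun f : C(I, ℝ) => ((s * f 1 : ℝ) : ℂ)) μ :=
    (hfin.integrable (hm.const_mul s)).ofReal
  have hi2 : Integrable (fun f : C(I, ℝ) => (((s * f 1) ^ 2 / 2 : ℝ) : ℂ)) μ :=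
    (hfin.integrable (((hm.const_mul s).pow_const 2).div_const 2)).ofReal
  have hi0 : Integrable (fun f : C(I, ℝ) => Complex.exp ((s * f 1 : ℝ) * Complex.I)) μ := by
    refine Integrable.of_bound ?_ 1 (ae_of_all _ fun f => ?_)
    · exact Measurable.aestronglyMeasurable (by fun_prop)
    · rw [Complex.norm_exp_ofReal_mul_I]
  have e1 : ∫ f, ((s * f 1 : ℝ) : ℂ) ∂μ = s * (sigma H)⁻¹ := by
    have := moment1_one_approxProb hH1 n
    rw [moment1] at this
    simp only [pow_one] at this
    rw [integral_complex_ofReal, integral_const_mul, hμ, this]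
    push_cast; rfl
  have e2 : ∫ f, (((s * f 1) ^ 2 / 2 : ℝ) : ℂ) ∂μ = s ^ 2 * moment1 2 μ / 2 := by
    rw [integral_complex_ofReal]
    simp_rw [mul_pow]
    rw [integral_div, integral_const_mul, moment1]
    push_cast; rfl
  have e : endChar μ s - (1 + s * (sigma H)⁻¹ * Complex.I - s ^ 2 * moment1 2 μ / 2) =
      ∫ f, (Complex.exp ((s * f 1 : ℝ) * Complex.I) -
        (1 + (s * f 1 : ℝ) * Complex.I - ((s * f 1 : ℝ) : ℂ) ^ 2 / 2)) ∂μ := by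
    have : ∀ f : C(I, ℝ), ((s * f 1 : ℝ) : ℂ) ^ 2 / 2 = (((s * f 1) ^ 2 / 2 : ℝ) : ℂ) := fun f => by
      push_cast; rfl
    simp_rw [this]
    have hi3 : Integrable (fun f : C(I, ℝ) => (1 : ℂ) + ((s * f 1 : ℝ) : ℂ) * Complex.I) μ :=
      (integrable_const _).add (hi1.mul_const _)
    have hi4 : Integrable (fun f : C(I, ℝ) => (1 : ℂ) + ((s * f 1 : ℝ) : ℂ) * Complex.I -
      (((s * f 1) ^ 2 / 2 : ℝ) : ℂ)) μ := hi3.sub hi2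
    rw [integral_sub hi0 hi4, integral_sub hi3 hi2,
      integral_add (integrable_const _) (hi1.mul_const _), integral_mul_const, e1, e2, endChar_eq]
    simp
  rw [e]
  refine (norm_integral_le_integral_norm _).trans ?_
  -- `|x|³ ≤ (x² + x⁴) / 2`
  have hb : ∀ f : C(I, ℝ), ‖Complex.exp ((s * f 1 : ℝ) * Complex.I) -
      (1 + (s * f 1 : ℝ) * Complex.I - ((s * f 1 : ℝ) : ℂ) ^ 2 / 2)‖ ≤
      2 * |s| ^ 3 * ((f 1) ^ 2 + (f 1) ^ 4) := by
    intro f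
    refine (norm_exp_sub_taylor_le (s * f 1)).trans ?_
    rw [abs_mul, mul_pow]
    have h1 : 2 * |f 1| ^ 3 ≤ (f 1) ^ 2 + (f 1) ^ 4 := by
      have : (f 1) ^ 2 + (f 1) ^ 4 = |f 1| ^ 2 + |f 1| ^ 4 := by
        rw [sq_abs, ← abs_pow, abs_of_nonneg (show 0 ≤ (f 1) ^ 4 by positivity)]
      rw [this]
      nlinarith [sq_nonneg (|f 1| * (1 - |f 1|))]
    have h2 := mul_le_mul_of_nonneg_left h1 (show 0 ≤ 2 * |s| ^ 3 by positivity)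
    linarith
  have hi3 : Integrable (fun f : C(I, ℝ) => 2 * |s| ^ 3 * ((f 1) ^ 2 + (f 1) ^ 4)) μ :=
    hfin.integrable (by fun_prop)
  refine (integral_mono_of_nonneg (ae_of_all _ fun f => norm_nonneg _) hi3
    (ae_of_all _ hb)).trans ?_
  rw [integral_const_mul, integral_add (hfin.integrable (by fun_prop))
    (hfin.integrable (by fun_prop))]
  have m2 := moment1_two_approxProb_le hH hH1 n
  have m4 := moment1_four_approxProb_le hH hH1 n
  rw [moment1] at m2 m4
  have : (∫ f, (f 1) ^ 2 ∂μ) + ∫ f, (f 1) ^ 4 ∂μ ≤ 12 := by linarith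
  have h2 := mul_le_mul_of_nonneg_left this (show 0 ≤ 2 * |s| ^ 3 by positivity)
  linarith

theorem tendsto_endChar {γ : Type*} {l : Filter γ} {μs : γ → ProbabilityMeasure C(I, ℝ)}
    {μ : ProbabilityMeasure C(I, ℝ)} (h : Tendsto μs l (𝓝 μ)) (s : ℝ) :
    Tendsto (fun i => endChar (μs i : Measure C(I, ℝ)) s) l (𝓝 (endChar (μ : Measure _) s)) := by
  have hc : Continuous fun f : C(I, ℝ) => Complex.exp (s * f 1 * Complex.I) := by
    have := continuous_eval_const (F := C(I, ℝ)) (1 : I)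
    fun_prop
  have h' := (ProbabilityMeasure.tendsto_iff_forall_integral_rclike_tendsto ℂ).1 h
    (BoundedContinuousFunction.ofNormedAddCommGroup _ hc 1 fun f => by
      rw [show (s : ℂ) * (f 1 : ℝ) = ((s * f 1 : ℝ) : ℂ) by push_cast; rfl,
        Complex.norm_exp_ofReal_mul_I])
  simp only [endChar_eq]
  exact h'

theorem norm_endChar_limitProb_sub_le (H : Set.Ioo (1 / 2 : ℝ) 1) {s : ℝ} (hs : |s| ≤ 1) :
    ‖endChar (limitProb H : Measure C(I, ℝ)) s - Real.exp (-(s ^ 2 / 2))‖ ≤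
      |s| * (sigma H)⁻¹ + 25 * |s| ^ 3 := by
  have h1 : ‖endChar (limitProb H : Measure C(I, ℝ)) s -
      (1 + s * (sigma H)⁻¹ * Complex.I - s ^ 2 * (1 : ℝ) / 2)‖ ≤ 24 * |s| ^ 3 := by
    have hm := (Complex.continuous_ofReal.tendsto 1).comp
      (tendsto_moment1_two_approxProb H.2.1 H.2.2)
    refine le_of_tendsto (((tendsto_endChar (tendsto_approxProb H) s).sub
      ((hm.const_mul ((s : ℂ) ^ 2)).div_const 2 |>.const_sub _)).norm)
      (Eventually.of_forall fun n => norm_endChar_approxProb_sub_le H.2.1 H.2.2 n s)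
  have hsq : s ^ 2 = |s| ^ 2 := (sq_abs s).symm
  have h2 : ‖((1 - s ^ 2 / 2 : ℝ) : ℂ) - Real.exp (-(s ^ 2 / 2))‖ ≤ |s| ^ 3 := by
    rw [← Complex.ofReal_sub, Complex.norm_real, Real.norm_eq_abs, abs_sub_comm]
    have hle : s ^ 2 ≤ 1 := by rw [hsq]; exact pow_le_one₀ (abs_nonneg s) hs
    have h := Real.abs_exp_sub_one_sub_id_le (x := -(s ^ 2 / 2)) (by
      rw [abs_neg, abs_of_nonneg (by positivity)]; linarith)
    rw [show Real.exp (-(s ^ 2 / 2)) - (1 - s ^ 2 / 2) =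
      Real.exp (-(s ^ 2 / 2)) - 1 - -(s ^ 2 / 2) by ring]
    refine h.trans ?_
    have h4 : |s| ^ 4 ≤ |s| ^ 3 := pow_le_pow_of_le_one (abs_nonneg s) hs (by norm_num)
    have : (-(s ^ 2 / 2)) ^ 2 = |s| ^ 4 / 4 := by rw [hsq]; ring
    have h0 : 0 ≤ |s| ^ 3 := by positivity
    linarith
  have h3 : ‖(s * (sigma H)⁻¹ * Complex.I : ℂ)‖ = |s| * (sigma H)⁻¹ := by
    rw [norm_mul, Complex.norm_I, mul_one, norm_mul, Complex.norm_real, Real.norm_eq_abs,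
      Complex.norm_real, Real.norm_of_nonneg (inv_sigma_nonneg H H.2.1)]
  calc _ = ‖(endChar (limitProb H : Measure C(I, ℝ)) s -
        (1 + s * (sigma H)⁻¹ * Complex.I - s ^ 2 * (1 : ℝ) / 2)) + (s * (sigma H)⁻¹ * Complex.I) +
        (((1 - s ^ 2 / 2 : ℝ) : ℂ) - Real.exp (-(s ^ 2 / 2)))‖ := by
        congr 1; push_cast; ring
    _ ≤ 24 * |s| ^ 3 + |s| * (sigma H)⁻¹ + |s| ^ 3 :=
        (norm_add_le _ _).trans (add_le_add ((norm_add_le _ _).trans (add_le_add h1 h3.le)) h2)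
    _ = _ := by ring

/-- Iterating the contraction `n` times reduces the error at `s` to the error at `2^{-nH} s`. -/
theorem norm_endChar_limitProb_iterate (H : Set.Ioo (1 / 2 : ℝ) 1) (n : ℕ) (s : ℝ) :
    ‖endChar (limitProb H : Measure C(I, ℝ)) s - Real.exp (-(s ^ 2 / 2))‖ ≤
      2 ^ n * ‖endChar (limitProb H : Measure C(I, ℝ)) (((2 : ℝ) ^ (-(H : ℝ))) ^ n * s) -
        Real.exp (-((((2 : ℝ) ^ (-(H : ℝ))) ^ n * s) ^ 2 / 2))‖ +
      (2 ^ n - 1) * (s ^ 2 * (1 / 2 - ((2 : ℝ) ^ (-(H : ℝ))) ^ 2)) := by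
  have hsq := scale_sq_lt H.2.1
  induction n generalizing s with
  | zero => simp
  | succ n ih =>
    have h1 := norm_endChar_graftLaw_sub_le (signProb H) ((2 : ℝ) ^ (-(H : ℝ))) hsq.le
      (limitProb H : Measure C(I, ℝ)) s
    have h2 : graftLaw (twoPoint (signProb H) ((2 : ℝ) ^ (-(H : ℝ))))
        (limitProb H : Measure C(I, ℝ)) = limitProb H :=
      (congrArg Subtype.val (limitProb_eq_graftProb H)).symm
    rw [h2] at h1
    have h3 := ih ((2 : ℝ) ^ (-(H : ℝ)) * s)
    have hpos : 0 < (2 : ℝ) ^ (-(H : ℝ)) := by positivity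
    generalize (2 : ℝ) ^ (-(H : ℝ)) = h at *
    rw [← mul_assoc, ← pow_succ] at h3
    have h4 : (h * s) ^ 2 * (1 / 2 - h ^ 2) ≤ s ^ 2 * (1 / 2 - h ^ 2) := by
      refine mul_le_mul_of_nonneg_right ?_ (by linarith)
      rw [mul_pow]
      exact mul_le_of_le_one_left (sq_nonneg s) (by linarith)
    have h5 : (0 : ℝ) ≤ 2 ^ n - 1 := by linarith [one_le_pow₀ (M₀ := ℝ) one_le_two (n := n)]
    have h6 := mul_le_mul_of_nonneg_left h4 h5
    rw [pow_succ (2 : ℝ)]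
    linarith

/-! ### Behaviour as `H` tends to `1/2` -/

/-- The filter of `H` tending to `1/2` within `(1/2, 1)`. -/
noncomputable def nearHalf : Filter (Set.Ioo (1 / 2 : ℝ) 1) :=
  comap (fun H : Set.Ioo (1 / 2 : ℝ) 1 => (H : ℝ)) (𝓝 (1 / 2))

instance : nearHalf.IsCountablyGenerated := by unfold nearHalf; infer_instance

theorem tendsto_scale : Tendsto (fun H : Set.Ioo (1 / 2 : ℝ) 1 => (2 : ℝ) ^ (-(H : ℝ))) nearHalf
    (𝓝 ((2 : ℝ) ^ (-(1 / 2) : ℝ))) := by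
  have hc : Continuous fun x : ℝ => (2 : ℝ) ^ (-x) :=
    Real.continuous_const_rpow two_ne_zero |>.comp continuous_neg
  exact (hc.tendsto (1 / 2)).comp tendsto_comap

theorem scale_half_sq : ((2 : ℝ) ^ (-(1 / 2) : ℝ)) ^ 2 = 1 / 2 := by
  rw [← Real.rpow_natCast, ← Real.rpow_mul two_pos.le]
  norm_num [Real.rpow_neg_one]

theorem tendsto_inv_sigma :
    Tendsto (fun H : Set.Ioo (1 / 2 : ℝ) 1 => (sigma H)⁻¹) nearHalf (𝓝 0) := by
  have h1 : Tendsto (fun H : Set.Ioo (1 / 2 : ℝ) 1 =>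
      √(2 - 4 * ((2 : ℝ) ^ (-(H : ℝ))) ^ 2)) nearHalf (𝓝 0) := by
    have := (((tendsto_scale.pow 2).const_mul 4).const_sub 2).sqrt
    rw [scale_half_sq] at this
    rwa [show (2 : ℝ) - 4 * (1 / 2) = 0 by norm_num, Real.sqrt_zero] at this
  refine h1.congr fun H => ?_
  rw [← inv_sigma_sq H.2.1, Real.sqrt_sq (inv_sigma_nonneg H H.2.1)]

theorem tendsto_endChar_limitProb (s : ℝ) :
    Tendsto (fun H => endChar (limitProb H : Measure C(I, ℝ)) s) nearHalf
      (𝓝 (Real.exp (-(s ^ 2 / 2)) : ℂ)) := by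
  have hδ : Tendsto (fun n : ℕ => √(1 / 2) ^ n) atTop (𝓝 0) :=
    tendsto_pow_atTop_nhds_zero_of_lt_one (Real.sqrt_nonneg _)
      ((Real.sqrt_lt' one_pos).2 (by norm_num))
  have h2δ : ∀ n : ℕ, (2 : ℝ) ^ n * (√(1 / 2) ^ n) ^ 3 = √(1 / 2) ^ n := fun n => by
    have : √(1 / 2 : ℝ) ^ 2 = 1 / 2 := Real.sq_sqrt (by norm_num)
    have h : (2 : ℝ) ^ n * (√(1 / 2) ^ n) ^ 2 = 1 := by
      rw [← pow_mul, mul_comm n 2, pow_mul, this, ← mul_pow]; norm_num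
    calc _ = (2 : ℝ) ^ n * (√(1 / 2) ^ n) ^ 2 * √(1 / 2) ^ n := by ring
      _ = _ := by rw [h, one_mul]
  rw [tendsto_iff_norm_sub_tendsto_zero, Metric.tendsto_nhds]
  intro ε hε
  have hn1 : ∀ᶠ n : ℕ in atTop, √(1 / 2) ^ n * |s| < 1 :=
    (by simpa using hδ.mul_const |s| : Tendsto (fun n : ℕ => √(1 / 2) ^ n * |s|) atTop
      (𝓝 0)).eventually_lt_const one_pos
  have hn2 : ∀ᶠ n : ℕ in atTop, √(1 / 2) ^ n * (25 * |s| ^ 3) < ε / 2 :=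
    (by simpa using hδ.mul_const (25 * |s| ^ 3) : Tendsto
      (fun n : ℕ => √(1 / 2) ^ n * (25 * |s| ^ 3)) atTop (𝓝 0)).eventually_lt_const (by positivity)
  obtain ⟨n, h1, h2⟩ := (hn1.and hn2).exists
  have hH : ∀ᶠ H : Set.Ioo (1 / 2 : ℝ) 1 in nearHalf, 2 ^ n * (|s| * (sigma H)⁻¹) +
      (2 ^ n - 1) * (s ^ 2 * (1 / 2 - ((2 : ℝ) ^ (-(H : ℝ))) ^ 2)) < ε / 2 := by
    have h3 := ((tendsto_inv_sigma.const_mul |s|).const_mul (2 ^ n)).add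
      ((((tendsto_scale.pow 2).const_sub (1 / 2)).const_mul (s ^ 2)).const_mul (2 ^ n - 1))
    rw [scale_half_sq] at h3
    refine h3.eventually_lt_const ?_
    simpa using hε
  filter_upwards [hH] with H hH
  have hsq := scale_sq_lt H.2.1
  have hle : (2 : ℝ) ^ (-(H : ℝ)) ≤ √(1 / 2) := Real.le_sqrt_of_sq_le hsq.le
  have hpos : 0 < (2 : ℝ) ^ (-(H : ℝ)) := by positivity
  have hu : |((2 : ℝ) ^ (-(H : ℝ))) ^ n * s| ≤ √(1 / 2) ^ n * |s| := by
    rw [abs_mul, abs_of_pos (pow_pos hpos n)]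
    gcongr
  have hu' : |((2 : ℝ) ^ (-(H : ℝ))) ^ n * s| ≤ |s| := by
    refine hu.trans (mul_le_of_le_one_left (abs_nonneg s) (pow_le_one₀ (Real.sqrt_nonneg _) ?_))
    exact Real.sqrt_le_one.2 (by norm_num)
  rw [Real.dist_eq, sub_zero, abs_of_nonneg (norm_nonneg _)]
  refine (norm_endChar_limitProb_iterate H n s).trans_lt ?_
  have h4 := norm_endChar_limitProb_sub_le H (hu.trans h1.le)
  have h5 : |((2 : ℝ) ^ (-(H : ℝ))) ^ n * s| * (sigma H)⁻¹ +
      25 * |((2 : ℝ) ^ (-(H : ℝ))) ^ n * s| ^ 3 ≤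
      |s| * (sigma H)⁻¹ + 25 * (√(1 / 2) ^ n * |s|) ^ 3 := by
    have := inv_sigma_nonneg H H.2.1
    gcongr
  have h6 := mul_le_mul_of_nonneg_left (h4.trans h5) (show (0 : ℝ) ≤ 2 ^ n by positivity)
  have h7 : (2 : ℝ) ^ n * (25 * (√(1 / 2) ^ n * |s|) ^ 3) = √(1 / 2) ^ n * (25 * |s| ^ 3) := by
    calc _ = (2 : ℝ) ^ n * (√(1 / 2) ^ n) ^ 3 * (25 * |s| ^ 3) := by ring
      _ = _ := by rw [h2δ]
  rw [mul_add, h7] at h6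
  linarith

/-- The endpoint of `B_H / σ_H` is asymptotically standard Gaussian. -/
theorem tendsto_map_eval_one_limitProb :
    Tendsto (fun H => (limitProb H).map (measurable_eval 1).aemeasurable) nearHalf
      (𝓝 ⟨gaussianReal 0 1, inferInstance⟩) := by
  refine tendsto_of_seq_tendsto fun x hx => ?_
  refine ProbabilityMeasure.tendsto_of_tendsto_charFun fun s => ?_
  have h := (tendsto_endChar_limitProb s).comp hx
  have e : charFun (gaussianReal 0 1) s = (Real.exp (-(s ^ 2 / 2)) : ℂ) := by
    rw [charFun_gaussianReal]; push_cast; ring_nf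
  exact e ▸ h

/-! ### The Gaussian cascade -/

/-- The factor `2^{-1/2}`. -/
noncomputable def halfScale : ℝ := (2 : ℝ) ^ (-(1 / 2) : ℝ)

theorem halfScale_mul_self : halfScale * halfScale = 1 / 2 := by
  rw [← sq]; exact scale_half_sq

theorem halfScale_pos : 0 < halfScale := by unfold halfScale; positivity

theorem tendsto_stepProb :
    Tendsto (fun H : Set.Ioo (1 / 2 : ℝ) 1 => stepProb H) nearHalf (𝓝 (stepProb (1 / 2))) := by
  have hp : Continuous signProb := by
    have := Real.continuous_const_rpow (two_ne_zero (α := ℝ))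
    exact continuous_projIcc.comp (by fun_prop)
  have hp' : Tendsto (fun H : Set.Ioo (1 / 2 : ℝ) 1 => (signProb H : ℝ)) nearHalf
      (𝓝 (signProb (1 / 2))) :=
    ((continuous_subtype_val.comp hp).tendsto _).comp tendsto_comap
  rw [ProbabilityMeasure.tendsto_iff_forall_integral_tendsto]
  intro F
  have e : ∀ H : ℝ, ∫ x, F x ∂(stepProb H : Measure ℝ) =
      signProb H * F ((2 : ℝ) ^ (-H)) + (1 - signProb H) * F (-(2 : ℝ) ^ (-H)) := by
    intro H
    change ∫ x, F x ∂(stepLaw H) = _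
    rw [stepLaw, twoPoint, integral_add_measure ((F.integrable _).smul_measure
        ENNReal.ofReal_ne_top) ((F.integrable _).smul_measure ENNReal.ofReal_ne_top),
      integral_smul_measure, integral_smul_measure, integral_dirac, integral_dirac,
      ENNReal.toReal_ofReal (signProb H).2.1,
      ENNReal.toReal_ofReal (by linarith [(signProb H).2.2]), smul_eq_mul, smul_eq_mul]
  simp only [e]
  exact (hp'.mul ((F.continuous.tendsto _).comp tendsto_scale)).add
    ((hp'.const_sub 1).mul ((F.continuous.tendsto _).comp tendsto_scale.neg))

/-- The law of the interpolation of level `n` of a standard Brownian motion. -/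
noncomputable def gaussProb : ℕ → ProbabilityMeasure C(I, ℝ)
  | 0 => ⟨(gaussianReal 0 1).map fun x => x • line,
      Measure.isProbabilityMeasure_map (by fun_prop)⟩
  | n + 1 => graftProb (stepProb (1 / 2)) (gaussProb n)

theorem tendsto_interpProb_limitProb (N : ℕ) :
    Tendsto (fun H => interpProb N (limitProb H)) nearHalf (𝓝 (gaussProb N)) := by
  induction N with
  | zero =>
    have hc : Continuous fun x : ℝ => x • line := by fun_prop
    refine (((ProbabilityMeasure.continuous_map hc).tendsto _).comp
      tendsto_map_eval_one_limitProb).congr fun H => Subtype.ext ?_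
    exact Measure.map_map hc.measurable (measurable_eval 1)
  | succ N ih =>
    simp only [interpProb_succ_limitProb]
    exact (continuous_graftProb.tendsto (stepProb (1 / 2), gaussProb N)).comp
      (tendsto_stepProb.prodMk_nhds ih)

/-- Scaling a symmetric law with a random sign amounts to deterministic scaling. -/
theorem scaleLaw_stepLaw_half {μ : Measure C(I, ℝ)} [IsProbabilityMeasure μ]
    (hμ : μ.map (fun f => -f) = μ) :
    scaleLaw (stepLaw (1 / 2)) μ = μ.map fun f => halfScale • f := by
  have h : μ.map (fun f => (-halfScale) • f) = μ.map fun f => halfScale • f := by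
    nth_rw 2 [← hμ]
    rw [Measure.map_map (by fun_prop) (by fun_prop)]
    congr 1
    ext f t
    simp
  rw [stepLaw, scaleLaw_twoPoint]
  change _ • μ.map (fun f => halfScale • f) + _ • μ.map (fun f => (-halfScale) • f) = _
  rw [h, ← add_smul, ← ENNReal.ofReal_add (signProb _).2.1 (by linarith [(signProb (1 / 2)).2.2])]
  simp

theorem map_neg_gaussProb (n : ℕ) :
    (gaussProb n : Measure C(I, ℝ)).map (fun f => -f) = gaussProb n := by
  induction n with
  | zero =>
    change ((gaussianReal 0 1).map fun x => x • line).map _ = (gaussianReal 0 1).map fun x => x • line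
    have h := gaussianReal_map_neg (μ := 0) (v := 1)
    rw [neg_zero] at h
    nth_rw 2 [← h]
    rw [Measure.map_map (by fun_prop) (by fun_prop), Measure.map_map (by fun_prop) (by fun_prop)]
    congr 1
    funext x
    simp
  | succ n ih =>
    change (graftLaw (stepLaw (1 / 2)) (gaussProb n : Measure C(I, ℝ))).map _ =
      graftLaw (stepLaw (1 / 2)) (gaussProb n : Measure C(I, ℝ))
    have hs : (scaleLaw (stepLaw (1 / 2)) (gaussProb n : Measure C(I, ℝ))).map (fun f => -f) =
        scaleLaw (stepLaw (1 / 2)) (gaussProb n : Measure C(I, ℝ)) := by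
      rw [scaleLaw_stepLaw_half ih, Measure.map_map (by fun_prop) (by fun_prop)]
      nth_rw 2 [← ih]
      rw [Measure.map_map (by fun_prop) (by fun_prop)]
      congr 1
      funext f
      simp
    have hn : Measurable fun f : C(I, ℝ) => -f := by fun_prop
    conv_rhs => rw [graftLaw, ← hs]
    rw [graftLaw, Measure.map_map hn continuous_glue.measurable, Measure.map_prod_map _ _ hn hn,
      Measure.map_map continuous_glue.measurable (hn.prodMap hn)]
    congr 1
    funext q
    simp only [Function.comp_apply, Prod.map]
    rw [← neg_one_smul ℝ (glue q), smul_glue]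
    simp

/-- The polygonal approximations of a Brownian bridge, built by midpoint displacement from
standard Gaussian labels. -/
noncomputable def bridge : ℕ → (List Bool → ℝ) → C(I, ℝ)
  | 0, _ => 0
  | n + 1, e => halfScale • glue ((halfScale * e []) • line + bridge n (subtree false e),
      (-(halfScale * e [])) • line + bridge n (subtree true e))

theorem measurable_bridge (n : ℕ) : Measurable (bridge n) := by
  induction n with
  | zero => exact measurable_const
  | succ n ih =>
    have h : Measurable fun e : List Bool → ℝ => (halfScale * e []) := by fun_prop
    refine (continuous_const_smul halfScale).measurable.comp
      (continuous_glue.measurable.comp (Measurable.prodMk ?_ ?_))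
    · exact (h.smul_const line).add (ih.comp (measurable_subtree _))
    · exact (h.neg.smul_const line).add (ih.comp (measurable_subtree _))

theorem bridge_zero_apply (n : ℕ) (e : List Bool → ℝ) : bridge n e 0 = 0 := by
  induction n generalizing e with
  | zero => rfl
  | succ n ih => simp [bridge, glue_zero, ih]

theorem bridge_one_apply (n : ℕ) (e : List Bool → ℝ) : bridge n e 1 = 0 := by
  induction n generalizing e with
  | zero => rfl
  | succ n ih => simp [bridge, glue_one, ih]

theorem bridge_succ_sub (n : ℕ) (e : List Bool → ℝ) :
    bridge (n + 2) e - bridge (n + 1) e = halfScale •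
      glue (bridge (n + 1) (subtree false e) - bridge n (subtree false e),
        bridge (n + 1) (subtree true e) - bridge n (subtree true e)) := by
  rw [bridge, bridge.eq_2 e n, ← smul_sub, glue_sub, add_sub_add_left_eq_sub,
    add_sub_add_left_eq_sub]

/-- Adding a linear drift: the halves of `z t + b_{n+1}(t)` are of the same form, with end values
obtained from `z` and the root label by an orthogonal transformation. -/
theorem smul_line_add_bridge_succ (n : ℕ) (z : ℝ) (e : List Bool → ℝ) :
    z • line + bridge (n + 1) e = glue
      (halfScale • ((halfScale * (z + e [])) • line + bridge n (subtree false e)),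
        halfScale • ((halfScale * (z - e [])) • line + bridge n (subtree true e))) := by
  have h : z • line = glue ((z / 2) • line, (z / 2) • line) := by
    rw [← smul_glue, glue_line, smul_smul]; congr 1; ring
  rw [h, bridge, smul_glue, glue_add]
  have e1 := halfScale_mul_self
  congr 2 <;> ext t <;> simp <;> linear_combination (-z) * (t : ℝ) * e1

theorem measurePreserving_rotation :
    MeasurePreserving (fun p : ℝ × ℝ => (halfScale * (p.1 + p.2), halfScale * (p.1 - p.2)))
      ((gaussianReal 0 1).prod (gaussianReal 0 1)) ((gaussianReal 0 1).prod (gaussianReal 0 1)) := by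
  refine ⟨by fun_prop, ?_⟩
  have h := IsGaussian.map_rotation_eq_self (μ := gaussianReal 0 1)
    (by simp [integral_id_gaussianReal]) (Real.pi / 4)
  nth_rw 1 [← Measure.prod_swap]
  rw [Measure.map_map (by fun_prop) (by fun_prop)]
  have hs : halfScale = √2 / 2 := by
    have h2 : √2 * √2 = 2 := Real.mul_self_sqrt (by norm_num)
    have h3 := halfScale_mul_self
    have h4 := halfScale_pos
    have h5 : 0 < √2 := by positivity
    nlinarith
  refine Eq.trans ?_ h
  congr 1
  funext p
  simp only [Function.comp_apply, Prod.swap, ContinuousLinearMap.rotation_apply, smul_eq_mul,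
    Real.cos_pi_div_four, Real.sin_pi_div_four, hs]
  ext <;> dsimp only <;> ring

/-- Rearranging a product of four measures by exchanging the inner factors. -/
theorem map_prod_prod_comm {α β γ δ : Type*} [MeasurableSpace α] [MeasurableSpace β]
    [MeasurableSpace γ] [MeasurableSpace δ] (a : Measure α) (b : Measure β) (c : Measure γ)
    (d : Measure δ) [SFinite a] [SFinite b] [SFinite c] [SFinite d] :
    ((a.prod b).prod (c.prod d)).map (fun p => ((p.1.1, p.2.1), (p.1.2, p.2.2))) =
      (a.prod c).prod (b.prod d) := by
  have h1 := measurePreserving_prodAssoc a b (c.prod d)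
  have h2 := (measurePreserving_prodAssoc b c d).symm
  have h3 := (Measure.measurePreserving_swap (μ := b) (ν := c)).prod (MeasurePreserving.id d)
  have h4 := measurePreserving_prodAssoc c b d
  have h5 := (MeasurePreserving.id a).prod (h4.comp (h3.comp h2))
  have h6 := (measurePreserving_prodAssoc a c (b.prod d)).symm
  exact (h6.comp (h5.comp h1)).map_eq

/-- The approximation `z t + b_n(t)` of Brownian motion, for independent Gaussian `z` and `b_n`,
has the law obtained by grafting. -/
theorem map_smul_line_add_bridge (n : ℕ) :
    ((gaussianReal 0 1).prod (treeLaw (gaussianReal 0 1))).map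
      (fun p => p.1 • line + bridge n p.2) = gaussProb n := by
  set γ := gaussianReal 0 1 with hγ
  set T := treeLaw γ with hT
  have hm : ∀ n, Measurable fun p : ℝ × (List Bool → ℝ) => p.1 • line + bridge n p.2 := fun n =>
    (measurable_fst.smul_const line).add ((measurable_bridge n).comp measurable_snd)
  induction n with
  | zero =>
    simp only [bridge, add_zero]
    change _ = γ.map fun x => x • line
    rw [← Function.comp_def (fun x : ℝ => x • line) Prod.fst,
      ← Measure.map_map (by fun_prop) measurable_fst, Measure.map_fst_prod, measure_univ, one_smul]
  | succ n ih =>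
    have hf : Measurable fun f : C(I, ℝ) => halfScale • f := (continuous_const_smul _).measurable
    change _ = graftLaw (stepLaw (1 / 2)) (gaussProb n : Measure C(I, ℝ))
    rw [graftLaw, scaleLaw_stepLaw_half (map_neg_gaussProb n), ← ih, Measure.map_map hf (hm n),
      Measure.map_prod_map _ _ (hf.comp (hm n)) (hf.comp (hm n)),
      Measure.map_map continuous_glue.measurable ((hf.comp (hm n)).prodMap (hf.comp (hm n)))]
    have h1 : MeasurePreserving
        (fun e : List Bool → ℝ => (e [], (subtree false e, subtree true e))) T
        (γ.prod (T.prod T)) := ⟨by fun_prop, map_root_subtrees γ⟩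
    have h2 := (MeasurePreserving.id γ).prod h1
    have h3 := (measurePreserving_prodAssoc γ γ (T.prod T)).symm
    have h4 := measurePreserving_rotation.prod (MeasurePreserving.id (T.prod T))
    have h5 : MeasurePreserving (fun p : (ℝ × ℝ) × ((List Bool → ℝ) × (List Bool → ℝ)) =>
        ((p.1.1, p.2.1), (p.1.2, p.2.2))) ((γ.prod γ).prod (T.prod T))
        ((γ.prod T).prod (γ.prod T)) := ⟨by fun_prop, map_prod_prod_comm γ γ T T⟩
    have h6 := h5.comp (h4.comp (h3.comp h2))
    rw [← h6.map_eq, Measure.map_map _ h6.measurable]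
    · congr 1
      funext p
      exact smul_line_add_bridge_succ n p.1 p.2
    · exact continuous_glue.measurable.comp ((hf.comp (hm n)).prodMap (hf.comp (hm n)))

/-! ### Convergence of the Gaussian cascade -/

theorem map_subtree (ν : Measure ℝ) [IsProbabilityMeasure ν] (b : Bool) :
    (treeLaw ν).map (subtree b) = treeLaw ν := by
  have h := map_subtrees ν
  cases b
  · have h' := congrArg (Measure.map Prod.fst) h
    rwa [Measure.map_map measurable_fst (by fun_prop), Measure.map_fst_prod, measure_univ,
      one_smul] at h'
  · have h' := congrArg (Measure.map Prod.snd) h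
    rwa [Measure.map_map measurable_snd (by fun_prop), Measure.map_snd_prod, measure_univ,
      one_smul] at h'

theorem measurable_bridge_sub (n : ℕ) : Measurable fun e => bridge (n + 1) e - bridge n e :=
  (measurable_bridge (n + 1)).sub (measurable_bridge n)

theorem norm_bridge_one_sub_le (e : List Bool → ℝ) : ‖bridge 1 e - bridge 0 e‖ ≤ |e []| := by
  have h := norm_glue_le ((halfScale * e []) • line) ((-(halfScale * e [])) • line) (by simp)
  have h1 : ‖(halfScale * e []) • line‖ ≤ halfScale * |e []| := by
    rw [norm_smul, norm_mul, Real.norm_of_nonneg halfScale_pos.le, Real.norm_eq_abs]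
    exact mul_le_of_le_one_right (mul_nonneg halfScale_pos.le (abs_nonneg _)) norm_line_le
  have h2 : ‖(-(halfScale * e [])) • line‖ ≤ halfScale * |e []| := by rwa [neg_smul, norm_neg]
  have h3 : |((halfScale * e []) • line) 1| = halfScale * |e []| := by
    simp [abs_mul, abs_of_pos halfScale_pos]
  simp only [bridge, add_zero, sub_zero]
  rw [norm_smul, Real.norm_of_nonneg halfScale_pos.le]
  have h4 := mul_le_mul_of_nonneg_left (h.trans (add_le_add (max_le h1 h2) h3.le)) halfScale_pos.le
  refine h4.trans (le_of_eq ?_)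
  linear_combination 2 * |e []| * halfScale_mul_self

theorem lintegral_bridge_sub_le (n : ℕ) :
    ∫⁻ e, ENNReal.ofReal (‖bridge (n + 1) e - bridge n e‖ ^ 4) ∂(treeLaw (gaussianReal 0 1)) ≤
      ENNReal.ofReal ((∫ x, x ^ 4 ∂(gaussianReal 0 1)) * (1 / 2) ^ n) := by
  set T := treeLaw (gaussianReal 0 1) with hT
  induction n with
  | zero =>
    have hi : Integrable (fun x : ℝ => x ^ 4) (gaussianReal 0 1) := by
      have h := (memLp_id_gaussianReal (μ := 0) (v := 1) 4).integrable_norm_pow (p := 4)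
        (by norm_num)
      refine h.congr (ae_of_all _ fun x => ?_)
      dsimp only [id]
      rw [Real.norm_eq_abs, ← abs_pow, abs_of_nonneg (by positivity)]
    rw [pow_zero, mul_one, ofReal_integral_eq_lintegral_ofReal hi
      (ae_of_all _ fun x => by positivity)]
    have h0 : T.map (fun e => e []) = gaussianReal 0 1 := Measure.infinitePi_map_eval _ _
    rw [← h0, lintegral_map (by fun_prop) (by fun_prop)]
    refine lintegral_mono fun e => ENNReal.ofReal_le_ofReal ?_
    have := pow_le_pow_left₀ (norm_nonneg _) (norm_bridge_one_sub_le e) 4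
    rwa [← abs_pow, abs_of_nonneg (show 0 ≤ (e []) ^ 4 by positivity)] at this
  | succ n ih =>
    set F : (List Bool → ℝ) → ENNReal :=
      fun e => ENNReal.ofReal (‖bridge (n + 1) e - bridge n e‖ ^ 4) with hF
    have hFm : Measurable F := ((measurable_bridge_sub n).norm.pow_const 4).ennreal_ofReal
    have hpt : ∀ e, ENNReal.ofReal (‖bridge (n + 1 + 1) e - bridge (n + 1) e‖ ^ 4) ≤
        ENNReal.ofReal (1 / 4) * (F (subtree false e) + F (subtree true e)) := by
      intro e
      rw [hF, ← ENNReal.ofReal_add (by positivity) (by positivity),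
        ← ENNReal.ofReal_mul (by norm_num)]
      refine ENNReal.ofReal_le_ofReal ?_
      have h4 : halfScale ^ 4 = 1 / 4 := by
        rw [show halfScale ^ 4 = (halfScale * halfScale) * (halfScale * halfScale) by ring,
          halfScale_mul_self]; norm_num
      rw [bridge_succ_sub, norm_smul, Real.norm_of_nonneg halfScale_pos.le, mul_pow, h4]
      refine mul_le_mul_of_nonneg_left ?_ (by norm_num)
      exact norm_glue_pow_four_le_of_bridge _ _
        (by simp [bridge_zero_apply]) (by simp [bridge_one_apply])
    have hsub : ∀ b, ∫⁻ e, F (subtree b e) ∂T = ∫⁻ e, F e ∂T := fun b => by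
      conv_rhs => rw [hT, ← map_subtree _ b]
      rw [lintegral_map hFm (measurable_subtree b)]
    refine (lintegral_mono hpt).trans ?_
    rw [lintegral_const_mul' _ _ ENNReal.ofReal_ne_top,
      lintegral_add_left (f := fun e => F (subtree false e)) (hFm.comp (measurable_subtree _)), hsub, hsub]
    refine (mul_le_mul_right (add_le_add ih ih) _).trans ?_
    have hK : 0 ≤ ∫ x, x ^ 4 ∂(gaussianReal 0 1) := integral_nonneg fun x => by positivity
    rw [← ENNReal.ofReal_add (by positivity) (by positivity), ← ENNReal.ofReal_mul (by norm_num)]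
    refine ENNReal.ofReal_le_ofReal (le_of_eq ?_)
    rw [pow_succ]; ring

theorem ae_tendsto_bridge : ∀ᵐ e ∂(treeLaw (gaussianReal 0 1)),
    Tendsto (fun n => bridge n e) atTop (𝓝 (limUnder atTop fun n => bridge n e)) := by
  have hs : (√√(1 / 2 : ℝ)) ^ 4 = 1 / 2 := by
    rw [show (√√(1 / 2 : ℝ)) ^ 4 = ((√√(1 / 2 : ℝ)) ^ 2) ^ 2 by ring,
      Real.sq_sqrt (by positivity), Real.sq_sqrt (by norm_num)]
  have hsum := ae_summable_norm (P := treeLaw (gaussianReal 0 1)) (s := √√(1 / 2 : ℝ))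
    (K := ∫ x, x ^ 4 ∂(gaussianReal 0 1)) measurable_bridge_sub
    (integral_nonneg fun x => by positivity) (by positivity)
    ((Real.sqrt_lt' one_pos).2 (by rw [one_pow]; exact (Real.sqrt_lt' one_pos).2 (by norm_num)))
    (by rw [hs]; exact lintegral_bridge_sub_le)
  filter_upwards [ae_exists_tendsto (Y := bridge) hsum] with e he
  exact tendsto_nhds_limUnder he

/-- A Brownian path: a linear path with Gaussian slope plus the limit of `bridge`. -/
noncomputable def wienerPath (p : ℝ × (List Bool → ℝ)) : C(I, ℝ) :=
  p.1 • line + limUnder atTop fun n => bridge n p.2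

theorem ae_tendsto_wienerPath :
    ∀ᵐ p ∂((gaussianReal 0 1).prod (treeLaw (gaussianReal 0 1))),
      Tendsto (fun n => p.1 • line + bridge n p.2) atTop (𝓝 (wienerPath p)) := by
  filter_upwards [Measure.quasiMeasurePreserving_snd.ae ae_tendsto_bridge] with p hp
  exact hp.const_add _

theorem measurable_smul_line_add_bridge (n : ℕ) :
    Measurable fun p : ℝ × (List Bool → ℝ) => p.1 • line + bridge n p.2 :=
  (measurable_fst.smul_const line).add ((measurable_bridge n).comp measurable_snd)

theorem aemeasurable_wienerPath :
    AEMeasurable wienerPath ((gaussianReal 0 1).prod (treeLaw (gaussianReal 0 1))) :=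
  aemeasurable_of_tendsto_metrizable_ae atTop
    (fun n => (measurable_smul_line_add_bridge n).aemeasurable) ae_tendsto_wienerPath

/-- The law of `wienerPath`. -/
noncomputable def wiener : ProbabilityMeasure C(I, ℝ) :=
  ⟨((gaussianReal 0 1).prod (treeLaw (gaussianReal 0 1))).map wienerPath,
    Measure.isProbabilityMeasure_map aemeasurable_wienerPath⟩

theorem tendsto_gaussProb : Tendsto gaussProb atTop (𝓝 wiener) := by
  have h := tendstoInDistribution_of_ae_tendsto
    (μ' := (gaussianReal 0 1).prod (treeLaw (gaussianReal 0 1))) (l := atTop)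
    (fun n => (measurable_smul_line_add_bridge n).aemeasurable) aemeasurable_wienerPath
    ae_tendsto_wienerPath
  refine (tendsto_congr fun n => ?_).2 h.tendsto
  exact Subtype.ext (map_smul_line_add_bridge n).symm

/-- Wiener measure is a fixed point of grafting at `H = 1/2`. -/
theorem graftProb_wiener : graftProb (stepProb (1 / 2)) wiener = wiener := by
  refine tendsto_nhds_unique ?_ ((tendsto_add_atTop_iff_nat 1).2 tendsto_gaussProb)
  exact (continuous_graftProb.tendsto (stepProb (1 / 2), wiener)).comp
    (tendsto_const_nhds.prodMk_nhds tendsto_gaussProb)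

theorem ae_wiener_apply_zero : ∀ᵐ f ∂(wiener : Measure C(I, ℝ)), f 0 = 0 := by
  refine (ae_map_iff aemeasurable_wienerPath (measurableSet_eq_fun (by fun_prop) (by fun_prop))).2 ?_
  filter_upwards [ae_tendsto_wienerPath] with p hp
  have h := ((continuous_eval_const (F := C(I, ℝ)) (0 : I)).tendsto _).comp hp
  simp only [Function.comp_def, ContinuousMap.add_apply, bridge_zero_apply] at h
  simpa using tendsto_nhds_unique h tendsto_const_nhds

theorem map_eval_one_wiener :
    (wiener : Measure C(I, ℝ)).map (fun f => f 1) = gaussianReal 0 1 := by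
  change (((gaussianReal 0 1).prod (treeLaw (gaussianReal 0 1))).map wienerPath).map _ = _
  rw [AEMeasurable.map_map_of_aemeasurable (measurable_eval 1).aemeasurable
    aemeasurable_wienerPath]
  have h : (fun f : C(I, ℝ) => f 1) ∘ wienerPath =ᵐ[(gaussianReal 0 1).prod
      (treeLaw (gaussianReal 0 1))] Prod.fst := by
    filter_upwards [ae_tendsto_wienerPath] with p hp
    have h := ((continuous_eval_const (F := C(I, ℝ)) (1 : I)).tendsto _).comp hp
    simp only [Function.comp_def, ContinuousMap.add_apply, bridge_one_apply] at h
    simpa using tendsto_nhds_unique h tendsto_const_nhds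
  rw [Measure.map_congr h, Measure.map_fst_prod, measure_univ, one_smul]

/-! ### Increments under the limit law -/

theorem map_neg_wiener : (wiener : Measure C(I, ℝ)).map (fun f => -f) = wiener := by
  have hc : Continuous fun f : C(I, ℝ) => -f := continuous_neg
  have h : wiener.map hc.measurable.aemeasurable = wiener := by
    refine tendsto_nhds_unique (((ProbabilityMeasure.continuous_map hc).tendsto _).comp
      tendsto_gaussProb) (tendsto_gaussProb.congr fun n => ?_)
    exact Subtype.ext (map_neg_gaussProb n).symm
  exact congrArg Subtype.val h

/-- The linear combination with coefficients `a` of the increments of `f` along `t`. -/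
def incrSum {n : ℕ} (t : Fin (n + 1) → I) (a : Fin n → ℝ) (f : C(I, ℝ)) : ℝ :=
  ∑ i, a i * (f (t i.succ) - f (t i.castSucc))

section IncrSum

variable {n : ℕ} (t : Fin (n + 1) → I) (a : Fin n → ℝ)

theorem measurable_incrSum : Measurable (incrSum t a) := by unfold incrSum; fun_prop

theorem incrSum_smul (c : ℝ) (f : C(I, ℝ)) : incrSum t a (c • f) = incrSum t (c • a) f := by
  simp only [incrSum, ContinuousMap.smul_apply, Pi.smul_apply, smul_eq_mul]
  exact Finset.sum_congr rfl fun i _ => by ring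

theorem incrSum_glue (f g : C(I, ℝ)) :
    incrSum t a (glue (f, g)) = incrSum (firstHalf ∘ t) a f + incrSum (secondHalf ∘ t) a g := by
  simp only [incrSum, glue_apply, Function.comp_apply]
  rw [← Finset.sum_add_distrib]
  exact Finset.sum_congr rfl fun i _ => by ring

/-- The joint characteristic function of the increments of a Wiener path. -/
noncomputable def incrChar : ℂ :=
  ∫ f, Complex.exp (incrSum t a f * Complex.I) ∂(wiener : Measure C(I, ℝ))

/-- Half the variance of `incrSum t a` for a Brownian motion. -/
noncomputable def incrVar : ℝ := ∑ i, (a i) ^ 2 / 2 * ((t i.succ : ℝ) - t i.castSucc)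

theorem incrChar_eq_mul : incrChar t a =
    incrChar (firstHalf ∘ t) (halfScale • a) * incrChar (secondHalf ∘ t) (halfScale • a) := by
  have hs : Measurable fun f : C(I, ℝ) => halfScale • f := (continuous_const_smul _).measurable
  have hE : Measurable fun f : C(I, ℝ) => Complex.exp (incrSum t a f * Complex.I) := by
    have := measurable_incrSum t a
    fun_prop
  have hw : (wiener : Measure C(I, ℝ)) = ((wiener : Measure C(I, ℝ)).prod wiener).map
      (glue ∘ Prod.map (fun f => halfScale • f) fun f => halfScale • f) := by
    have h : (wiener : Measure C(I, ℝ)) = graftLaw (stepLaw (1 / 2)) (wiener : Measure _) :=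
      (congrArg Subtype.val graftProb_wiener).symm
    rw [graftLaw, scaleLaw_stepLaw_half map_neg_wiener, Measure.map_prod_map _ _ hs hs,
      Measure.map_map continuous_glue.measurable (hs.prodMap hs)] at h
    exact h
  rw [incrChar, hw, integral_map (continuous_glue.measurable.comp (hs.prodMap hs)).aemeasurable
    hE.aestronglyMeasurable, incrChar, incrChar, ← integral_prod_mul]
  congr 1
  funext q
  simp only [Function.comp_apply, Prod.map]
  rw [incrSum_glue, incrSum_smul, incrSum_smul, ← Complex.exp_add]
  push_cast
  ring_nf

theorem incrVar_eq_add : incrVar t a =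
    incrVar (firstHalf ∘ t) (halfScale • a) + incrVar (secondHalf ∘ t) (halfScale • a) := by
  have h2 := halfScale_mul_self
  simp only [incrVar, Function.comp_apply, Pi.smul_apply, smul_eq_mul]
  rw [← Finset.sum_add_distrib]
  refine Finset.sum_congr rfl fun i _ => ?_
  have h3 := coe_firstHalf_add_coe_secondHalf (t i.succ)
  have h4 := coe_firstHalf_add_coe_secondHalf (t i.castSucc)
  linear_combination (-(a i) ^ 2 / 2) * (((t i.succ : ℝ) - t i.castSucc) * 2) * h2 -
    (halfScale * a i) ^ 2 / 2 * (h3 - h4)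

end IncrSum

/-- If all times are `0` or `1`, at most one increment does not vanish. -/
theorem incrChar_eq_of_zero_one {n : ℕ} {t : Fin (n + 1) → I} (ht : Monotone t)
    (h01 : ∀ j, t j = 0 ∨ t j = 1) (a : Fin n → ℝ) :
    incrChar t a = Real.exp (-incrVar t a) := by
  set x : ℝ := ∑ i, a i * ((t i.succ : ℝ) - t i.castSucc) with hx
  have h1 : incrChar t a = charFun ((wiener : Measure C(I, ℝ)).map fun f => f 1) x := by
    rw [charFun_apply_real, integral_map (measurable_eval 1).aemeasurable
      (Measurable.aestronglyMeasurable (by fun_prop)), incrChar]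
    refine integral_congr_ae ?_
    filter_upwards [ae_wiener_apply_zero] with f hf
    have hj : ∀ j, f (t j) = t j * f 1 := fun j => by
      rcases h01 j with h | h <;> simp [h, hf]
    have : incrSum t a f = x * f 1 := by
      rw [incrSum, hx, Finset.sum_mul]
      exact Finset.sum_congr rfl fun i _ => by rw [hj, hj]; ring
    rw [this]
    push_cast
    rfl
  have h2 : x ^ 2 / 2 = incrVar t a := by
    have key : ∀ i k : Fin n, i ≠ k →
        ((t i.succ : ℝ) - t i.castSucc) * ((t k.succ : ℝ) - t k.castSucc) = 0 := by
      intro i k hik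
      wlog hlt : i < k generalizing i k
      · rw [mul_comm]
        exact this k i hik.symm (lt_of_le_of_ne (not_lt.1 hlt) hik.symm)
      have hle1 : t i.castSucc ≤ t i.succ := ht i.castSucc_le_succ
      have hle2 : t i.succ ≤ t k.castSucc := ht (Fin.succ_le_castSucc_iff.2 hlt)
      have hle3 : t k.castSucc ≤ t k.succ := ht k.castSucc_le_succ
      rcases h01 i.succ with h | h
      · have : t i.castSucc = 0 := le_antisymm (h ▸ hle1) (t i.castSucc).2.1
        rw [h, this, sub_self, zero_mul]
      · have e1 : t k.castSucc = 1 := le_antisymm (t k.castSucc).2.2 (h ▸ hle2)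
        have e2 : t k.succ = 1 := le_antisymm (t k.succ).2.2 (e1 ▸ hle3)
        rw [e1, e2, sub_self, mul_zero]
    have hsq : ∀ i : Fin n, ((t i.succ : ℝ) - t i.castSucc) * ((t i.succ : ℝ) - t i.castSucc) =
        (t i.succ : ℝ) - t i.castSucc := by
      intro i
      have hle1 : t i.castSucc ≤ t i.succ := ht i.castSucc_le_succ
      rcases h01 i.succ with h | h <;> rcases h01 i.castSucc with h' | h' <;> rw [h, h'] <;>
        norm_num
      rw [h, h'] at hle1
      exact absurd hle1 (by simp)
    rw [sq, hx, Finset.sum_mul_sum, incrVar, Finset.sum_div]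
    refine Finset.sum_congr rfl fun i _ => ?_
    rw [Finset.sum_eq_single i]
    · linear_combination (a i) ^ 2 / 2 * hsq i
    · intro k _ hk
      linear_combination a i * a k * key i k hk.symm
    · simp
  rw [h1, map_eval_one_wiener, charFun_gaussianReal, ← h2]
  push_cast
  ring_nf

theorem incrChar_eq_of_dyadic {n : ℕ} (N : ℕ) {t : Fin (n + 1) → I} (ht : Monotone t)
    (hd : ∀ j, ∃ k : ℕ, 2 ^ N * (t j : ℝ) = k) (a : Fin n → ℝ) :
    incrChar t a = Real.exp (-incrVar t a) := by
  induction N generalizing t a with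
  | zero =>
    refine incrChar_eq_of_zero_one ht (fun j => ?_) a
    obtain ⟨k, hk⟩ := hd j
    rw [pow_zero, one_mul] at hk
    have hk1 : (k : ℝ) ≤ 1 := hk ▸ (t j).2.2
    have hk1' : k ≤ 1 := by exact_mod_cast hk1
    interval_cases k
    · left; ext; simpa using hk
    · right; ext; simpa using hk
  | succ N ih =>
    rw [incrChar_eq_mul, incrVar_eq_add, ih (monotone_firstHalf.comp ht), ih
      (monotone_secondHalf.comp ht), ← Complex.ofReal_mul, ← Real.exp_add, neg_add]
    · intro j
      obtain ⟨k, hk⟩ := hd j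
      refine ⟨k - 2 ^ N, ?_⟩
      rw [Function.comp_apply, coe_secondHalf]
      rw [pow_succ] at hk
      rcases le_total (2 ^ N) k with h | h
      · rw [Nat.cast_sub h, max_eq_left]
        · push_cast; linarith
        · have : (2 : ℝ) ^ N ≤ k := by exact_mod_cast h
          have hp : (0 : ℝ) < 2 ^ N := by positivity
          by_contra hc
          push Not at hc
          nlinarith
      · rw [Nat.sub_eq_zero_of_le h, max_eq_right]
        · simp
        · have : (k : ℝ) ≤ 2 ^ N := by exact_mod_cast h
          have hp : (0 : ℝ) < 2 ^ N := by positivity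
          by_contra hc
          push Not at hc
          nlinarith
    · intro j
      obtain ⟨k, hk⟩ := hd j
      refine ⟨min k (2 ^ N), ?_⟩
      rw [Function.comp_apply, coe_firstHalf, mul_min_of_nonneg _ _ (by positivity)]
      rw [pow_succ] at hk
      push_cast
      rw [← hk]
      ring_nf

/-- The largest dyadic number of level `N` below `t`. -/
noncomputable def dyadicFloor (N : ℕ) (t : I) : I :=
  ⟨⌊2 ^ N * (t : ℝ)⌋₊ / 2 ^ N, by positivity, by
    rw [div_le_one (by positivity)]
    exact (Nat.floor_le (mul_nonneg (by positivity) t.2.1)).trans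
      (mul_le_of_le_one_right (by positivity) t.2.2)⟩

theorem monotone_dyadicFloor (N : ℕ) : Monotone (dyadicFloor N) := by
  intro s t h
  have h' : (s : ℝ) ≤ t := h
  change (⌊2 ^ N * (s : ℝ)⌋₊ : ℝ) / 2 ^ N ≤ ⌊2 ^ N * (t : ℝ)⌋₊ / 2 ^ N
  gcongr

theorem tendsto_dyadicFloor (t : I) : Tendsto (fun N => dyadicFloor N t) atTop (𝓝 t) := by
  rw [tendsto_subtype_rng]
  have h := (tendsto_nat_floor_mul_div_atTop (R := ℝ) t.2.1).comp
    (tendsto_pow_atTop_atTop_of_one_lt (one_lt_two (α := ℝ)))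
  refine h.congr fun N => ?_
  simp only [Function.comp_apply, dyadicFloor, mul_comm]

/-- The increments have the joint characteristic function of those of Brownian motion. -/
theorem incrChar_eq {n : ℕ} {t : Fin (n + 1) → I} (ht : Monotone t) (a : Fin n → ℝ) :
    incrChar t a = Real.exp (-incrVar t a) := by
  have hN : ∀ N, incrChar (dyadicFloor N ∘ t) a = Real.exp (-incrVar (dyadicFloor N ∘ t) a) := by
    intro N
    refine incrChar_eq_of_dyadic N ((monotone_dyadicFloor N).comp ht) (fun j => ?_) a
    exact ⟨⌊2 ^ N * (t j : ℝ)⌋₊, mul_div_cancel₀ _ (by positivity)⟩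
  have h1 : Tendsto (fun N => incrChar (dyadicFloor N ∘ t) a) atTop (𝓝 (incrChar t a)) := by
    refine tendsto_integral_of_dominated_convergence (fun _ => 1) (fun N => ?_)
      (integrable_const _) (fun N => ae_of_all _ fun f => ?_) (ae_of_all _ fun f => ?_)
    · have := measurable_incrSum (dyadicFloor N ∘ t) a
      exact Measurable.aestronglyMeasurable (by fun_prop)
    · rw [Complex.norm_exp_ofReal_mul_I]
    · have hj : ∀ j, Tendsto (fun N => f ((dyadicFloor N ∘ t) j)) atTop (𝓝 (f (t j))) := fun j =>
        (f.continuous.tendsto _).comp (tendsto_dyadicFloor (t j))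
      have hs : Tendsto (fun N => incrSum (dyadicFloor N ∘ t) a f) atTop (𝓝 (incrSum t a f)) :=
        tendsto_finsetSum _ fun i _ => ((hj i.succ).sub (hj i.castSucc)).const_mul _
      have hc : Continuous fun x : ℝ => Complex.exp (x * Complex.I) := by fun_prop
      exact (hc.tendsto _).comp hs
  have h2 : Tendsto (fun N => (Real.exp (-incrVar (dyadicFloor N ∘ t) a) : ℂ)) atTop
      (𝓝 (Real.exp (-incrVar t a) : ℂ)) := by
    have hj : ∀ j, Tendsto (fun N => ((dyadicFloor N ∘ t) j : ℝ)) atTop (𝓝 (t j : ℝ)) := fun j =>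
      (continuous_subtype_val.tendsto _).comp (tendsto_dyadicFloor (t j))
    have hs : Tendsto (fun N => incrVar (dyadicFloor N ∘ t) a) atTop (𝓝 (incrVar t a)) :=
      tendsto_finsetSum _ fun i _ => ((hj i.succ).sub (hj i.castSucc)).const_mul _
    have hc : Continuous fun x : ℝ => (Real.exp (-x) : ℂ) := by fun_prop
    exact (hc.tendsto _).comp hs
  exact tendsto_nhds_unique (h1.congr hN) h2

theorem charFun_map_sub_wiener {s t : I} (hst : s ≤ t) (x : ℝ) :
    charFun ((wiener : Measure C(I, ℝ)).map fun f => f t - f s) x =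
      Real.exp (-(x ^ 2 / 2 * ((t : ℝ) - s))) := by
  have hm : Monotone ![s, t] := by
    rw [Fin.monotone_iff_le_succ]
    intro i
    fin_cases i
    simpa using hst
  have h := incrChar_eq hm ![x]
  have e : incrVar ![s, t] ![x] = x ^ 2 / 2 * ((t : ℝ) - s) := by simp [incrVar]
  rw [e] at h
  rw [← h, charFun_apply_real, integral_map (Measurable.aemeasurable (by fun_prop))
    (Measurable.aestronglyMeasurable (by fun_prop)), incrChar]
  congr 1
  funext f
  simp [incrSum]

theorem isWienerMeasure_wiener : IsWienerMeasure (wiener : Measure C(I, ℝ)) where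
  start := ae_wiener_apply_zero
  indep := by
    intro n t ht
    rw [iIndepFun_iff_charFun_pi fun i => Measurable.aemeasurable (by fun_prop)]
    intro a
    have h1 : ∀ i : Fin n, charFun ((wiener : Measure C(I, ℝ)).map
        fun f => f (t i.succ) - f (t i.castSucc)) (a i) =
        Real.exp (-((a i) ^ 2 / 2 * ((t i.succ : ℝ) - t i.castSucc))) := fun i =>
      charFun_map_sub_wiener (ht i.castSucc_le_succ) (a i)
    simp only [h1]
    rw [← Complex.ofReal_prod, ← Real.exp_sum, Finset.sum_neg_distrib]
    refine Eq.trans ?_ (incrChar_eq ht a)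
    have hmeas : Measurable fun f : C(I, ℝ) => WithLp.toLp 2
        fun i : Fin n => f (t i.succ) - f (t i.castSucc) := by fun_prop
    rw [charFun_apply, integral_map hmeas.aemeasurable
      (Continuous.aestronglyMeasurable (by fun_prop)), incrChar]
    rfl
  law s t hst := by
    refine ⟨Measurable.aemeasurable (by fun_prop), ?_⟩
    have : IsProbabilityMeasure ((wiener : Measure C(I, ℝ)).map fun f => f t - f s) :=
      Measure.isProbabilityMeasure_map (Measurable.aemeasurable (by fun_prop))
    refine Measure.ext_of_charFun (funext fun x => ?_)
    have hle : 0 ≤ (t : ℝ) - s := sub_nonneg.2 hst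
    rw [charFun_map_sub_wiener hst, charFun_gaussianReal, Real.coe_toNNReal _ hle]
    push_cast
    ring_nf

/-! ### Convergence in law -/

/-- Interpolation changes the integral of a Lipschitz function by little, uniformly in `H`. -/
theorem abs_integral_limitProb_sub_le (H : Set.Ioo (1 / 2 : ℝ) 1) (N : ℕ) {F : C(I, ℝ) → ℝ}
    {C : ℝ} (hC : ∀ f g, dist (F f) (F g) ≤ C) {L : NNReal} (hL : LipschitzWith L F) {u : ℝ}
    (hu : 0 < u) :
    |∫ f, F f ∂(limitProb H : Measure C(I, ℝ)) -
      ∫ f, F f ∂(interpProb N (limitProb H) : Measure C(I, ℝ))| ≤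
      L * (u + u⁻¹ ^ 3 * (81920 * (1 / 2) ^ N)) := by
  let G : BoundedContinuousFunction C(I, ℝ) ℝ :=
    BoundedContinuousFunction.mkOfBound ⟨F, hL.continuous⟩ C hC
  have h1 : Tendsto (fun n => approxProb H (n + N)) atTop (𝓝 (limitProb H)) :=
    (tendsto_add_atTop_iff_nat N).2 (tendsto_approxProb H)
  have h2 := ((continuous_interpProb N).tendsto _).comp h1
  have h3 := ProbabilityMeasure.tendsto_iff_forall_integral_tendsto.1 h1 G
  have h4 := ProbabilityMeasure.tendsto_iff_forall_integral_tendsto.1 h2 G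
  refine le_of_tendsto (h3.sub h4).abs (Eventually.of_forall fun n => ?_)
  have hfin := isFinitePathLaw_approxProb H (n + N)
  have hm := (continuous_interp N).measurable
  have hF : Measurable F := hL.continuous.measurable
  change |∫ f, F f ∂(approxProb H (n + N) : Measure C(I, ℝ)) -
    ∫ f, F f ∂((approxProb H (n + N) : Measure C(I, ℝ)).map (interp N))| ≤ _
  rw [integral_map hm.aemeasurable hF.aestronglyMeasurable,
    ← integral_sub (hfin.integrable hF)
      (hfin.integrable (F := fun f => F (interp N f)) (hF.comp hm))]
  -- `a ≤ u + a⁴ / u³` for every `u > 0`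
  have hpt : ∀ a : ℝ, 0 ≤ a → a ≤ u + u⁻¹ ^ 3 * a ^ 4 := by
    intro a ha
    rcases le_total a u with h | h
    · have : 0 ≤ u⁻¹ ^ 3 * a ^ 4 := by positivity
      linarith
    · have h3 : 1 ≤ u⁻¹ ^ 3 * a ^ 3 := by
        rw [← mul_pow, inv_mul_eq_div]
        exact one_le_pow₀ ((one_le_div hu).2 h)
      have h4 := mul_le_mul_of_nonneg_right h3 ha
      rw [one_mul, mul_assoc, ← pow_succ] at h4
      linarith
  have hi : Integrable (fun f => (L : ℝ) * (u + u⁻¹ ^ 3 * ‖f - interp N f‖ ^ 4))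
      (approxProb H (n + N) : Measure C(I, ℝ)) :=
    hfin.integrable (Continuous.measurable (by fun_prop))
  refine (abs_integral_le_integral_abs).trans ((integral_mono_of_nonneg
    (ae_of_all _ fun f => abs_nonneg _) hi (ae_of_all _ fun f => ?_)).trans ?_)
  · have := hL.dist_le_mul f (interp N f)
    rw [Real.dist_eq, dist_eq_norm] at this
    exact this.trans (mul_le_mul_of_nonneg_left (hpt _ (norm_nonneg _)) L.2)
  · rw [integral_const_mul, integral_add (integrable_const _)
      (hfin.integrable (Continuous.measurable (by fun_prop))), integral_const_mul]
    simp only [integral_const, probReal_univ, one_smul]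
    have := interp_error_approxProb_le H.2.1 H.2.2 N n
    gcongr

theorem tendsto_limitProb : Tendsto limitProb nearHalf (𝓝 wiener) := by
  rw [tendsto_iff_forall_lipschitz_integral_tendsto]
  rintro F ⟨C, hC⟩ ⟨L, hL⟩
  let G : BoundedContinuousFunction C(I, ℝ) ℝ :=
    BoundedContinuousFunction.mkOfBound ⟨F, hL.continuous⟩ C hC
  rw [Metric.tendsto_nhds]
  intro ε hε
  obtain ⟨u, hu, hLu⟩ : ∃ u : ℝ, 0 < u ∧ L * u < ε / 4 := by
    have hL1 : (0 : ℝ) < L + 1 := by positivity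
    refine ⟨ε / 4 / (L + 1), by positivity, ?_⟩
    rw [mul_div_assoc', div_lt_iff₀ hL1]
    nlinarith
  have hN1 : Tendsto (fun N : ℕ => (L : ℝ) * (u⁻¹ ^ 3 * (81920 * (1 / 2) ^ N))) atTop (𝓝 0) := by
    have := (((tendsto_pow_atTop_nhds_zero_of_lt_one (r := (1 / 2 : ℝ)) (by norm_num)
      (by norm_num)).const_mul 81920).const_mul (u⁻¹ ^ 3)).const_mul (L : ℝ)
    simpa using this
  have hN2 := ProbabilityMeasure.tendsto_iff_forall_integral_tendsto.1 tendsto_gaussProb G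
  obtain ⟨N, h1, h2⟩ := ((hN1.eventually_lt_const (show 0 < ε / 4 by positivity)).and
    (Metric.tendsto_nhds.1 hN2 (ε / 4) (by positivity))).exists
  have h3 := ProbabilityMeasure.tendsto_iff_forall_integral_tendsto.1
    (tendsto_interpProb_limitProb N) G
  filter_upwards [Metric.tendsto_nhds.1 h3 (ε / 4) (by positivity)] with H h3
  have h4 := abs_integral_limitProb_sub_le H N hC hL hu
  change dist (∫ f, F f ∂(gaussProb N : Measure C(I, ℝ))) (∫ f, F f ∂(wiener : Measure _)) < _ at h2
  change dist (∫ f, F f ∂(interpProb N (limitProb H) : Measure C(I, ℝ)))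
    (∫ f, F f ∂(gaussProb N : Measure _)) < _ at h3
  have h5 := dist_triangle4 (∫ f, F f ∂(limitProb H : Measure C(I, ℝ)))
    (∫ f, F f ∂(interpProb N (limitProb H) : Measure C(I, ℝ)))
    (∫ f, F f ∂(gaussProb N : Measure C(I, ℝ))) (∫ f, F f ∂(wiener : Measure C(I, ℝ)))
  rw [Real.dist_eq (∫ f, F f ∂(limitProb H : Measure C(I, ℝ)))
    (∫ f, F f ∂(interpProb N (limitProb H) : Measure C(I, ℝ)))] at h5
  linarith

/-! ### Sign families on arbitrary probability spaces -/

/-- A probability measure on `ℝ` carried by `1` and `-1` is determined by the two masses. -/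
theorem IsSignFamily.map_eq_signLaw {Ω : Type*} [MeasurableSpace Ω] {P : Measure Ω}
    [IsProbabilityMeasure P] {H : ℝ} (hH : H ≤ 1) {ε : List Bool → Ω → ℝ}
    (hε : IsSignFamily P H ε) (w : List Bool) : P.map (ε w) = signLaw H := by
  have hm := hε.measurable w
  have : IsProbabilityMeasure (P.map (ε w)) := Measure.isProbabilityMeasure_map hm.aemeasurable
  set μ := P.map (ε w) with hμ
  have h1 : μ {1} = ENNReal.ofReal (signProb H) := by
    rw [hμ, Measure.map_apply hm (measurableSet_singleton _), coe_signProb hH]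
    exact hε.prob_one w
  have h2 : μ {-1} = ENNReal.ofReal (1 - signProb H) := by
    rw [hμ, Measure.map_apply hm (measurableSet_singleton _), coe_signProb hH]
    refine (hε.prob_neg_one w).trans ?_
    congr 1
    ring
  have hdisj : Disjoint ({1} : Set ℝ) {-1} := by
    rw [Set.disjoint_singleton]; norm_num
  have hU : μ ({1} ∪ {-1}) = 1 := by
    rw [measure_union hdisj (measurableSet_singleton _), h1, h2,
      ← ENNReal.ofReal_add (signProb H).2.1 (by linarith [(signProb H).2.2])]
    simp
  have hc : ∀ᵐ x ∂μ, x ∈ ({1} ∪ {-1} : Set ℝ) :=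
    (prob_compl_eq_zero_iff ((measurableSet_singleton _).union (measurableSet_singleton _))).2 hU
  rw [← Measure.restrict_eq_self_of_ae_mem hc,
    Measure.restrict_union hdisj (measurableSet_singleton _), Measure.restrict_singleton,
    Measure.restrict_singleton, h1, h2]
  rfl

theorem IsSignFamily.measurePreserving {Ω : Type*} [MeasurableSpace Ω] {P : Measure Ω}
    [IsProbabilityMeasure P] {H : ℝ} (hH : H ≤ 1) {ε : List Bool → Ω → ℝ}
    (hε : IsSignFamily P H ε) :
    MeasurePreserving (fun ω w => ε w ω) P (treeLaw (signLaw H)) := by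
  have hm : Measurable fun ω w => ε w ω := measurable_pi_lambda _ hε.measurable
  refine ⟨hm, ?_⟩
  rw [hε.indep.map_fun_eq_infinitePi_map₀ hm.aemeasurable, treeLaw]
  congr 1
  funext w
  exact hε.map_eq_signLaw hH w

end SignedCascade

theorem theorem2 {Ω : Set.Ioo (1 / 2 : ℝ) 1 → Type*} [∀ H, MeasurableSpace (Ω H)]
    (P : ∀ H, Measure (Ω H)) [∀ H, IsProbabilityMeasure (P H)]
    (ε : ∀ H, List Bool → Ω H → ℝ)
    (hε : ∀ H, SignedCascade.IsSignFamily (P H) (H : ℝ) (ε H)) :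
    (∀ H : Set.Ioo (1 / 2 : ℝ) 1, ∀ᵐ ω ∂(P H),
      Tendsto (SignedCascade.approx (H : ℝ) (fun w => ε H w ω)) atTop
        (𝓝 (SignedCascade.limitPath (H : ℝ) (fun w => ε H w ω)))) ∧
    ∃ (W : Measure C(I, ℝ)) (_ : IsProbabilityMeasure W),
      SignedCascade.IsWienerMeasure W ∧
      TendstoInDistribution
        (fun (H : Set.Ioo (1 / 2 : ℝ) 1) (ω : Ω H) =>
          (SignedCascade.sigma (H : ℝ))⁻¹ •
            SignedCascade.limitPath (H : ℝ) (fun w => ε H w ω))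
        (comap (fun H : Set.Ioo (1 / 2 : ℝ) 1 => (H : ℝ)) (𝓝 (1 / 2)))
        (id : C(I, ℝ) → C(I, ℝ)) P W := by
  have hmp := fun H => (hε H).measurePreserving H.2.2.le
  have hae : ∀ H : Set.Ioo (1 / 2 : ℝ) 1, AEMeasurable
      (fun e => (SignedCascade.sigma (H : ℝ))⁻¹ • SignedCascade.limitPath (H : ℝ) e)
      (SignedCascade.treeLaw (SignedCascade.signLaw H)) := fun H =>
    SignedCascade.aemeasurable_smul_limitPath H.2.1 H.2.2.le _
  refine ⟨fun H => (hmp H).quasiMeasurePreserving.ae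
    (SignedCascade.ae_tendsto_approx H.2.1 H.2.2.le), SignedCascade.wiener, inferInstance,
    SignedCascade.isWienerMeasure_wiener, fun H => ?_, aemeasurable_id, ?_⟩
  · exact (hae H).comp_quasiMeasurePreserving (hmp H).quasiMeasurePreserving
  · have h := SignedCascade.tendsto_limitProb
    have hw : (⟨(SignedCascade.wiener : Measure C(I, ℝ)).map id,
        Measure.isProbabilityMeasure_map aemeasurable_id⟩ : ProbabilityMeasure C(I, ℝ)) =
        SignedCascade.wiener := Subtype.ext Measure.map_id
    rw [hw]
    refine h.congr fun H => Subtype.ext ?_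
    change (SignedCascade.treeLaw (SignedCascade.signLaw H)).map _ = (P H).map _
    rw [← (hmp H).map_eq, AEMeasurable.map_map_of_aemeasurable _ (hmp H).measurable.aemeasurable]
    · rfl
    · rw [(hmp H).map_eq]
      exact hae H
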